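/- For $x,a\in\mathbb{R}^d$ put $f_x(a)=\|a-x\|_2^2$; for $k\ge 1$ centres $X=(x_1,\dots,x_k)\in\mathbb{R}^{k\times d}$ put $f_X(a)=\min_j f_{x_j}(a)$. For points $A=(a_1,\dots,a_n)$ let $f_X(A)=\sum_i f_X(a_i)$, let $\varphi_i=\frac1i\sum_{j\le i}a_j$, $\varphi=\varphi_n$ and $f_\varphi(A)=\sum_i f_\varphi(a_i)$. For a finite collection $C$ of points $c$ with weights $\omega_c$ let $f_X(C)=\sum_{c\in C}\omega_c f_X(c)$. The algorithm ParametricFilter for squared Euclidean distance ($M=I$, $\mu=1$), with parameter $r>0$, starts with $S=0$ and $C=\emptyset$. When the $i$-th point $a_i$ of the stream arrives, it sets $\varphi_i=((i-1)\varphi_{i-1}+a_i)/i$ and $S\leftarrow S+f_{\varphi_i}(a_i)$; it sets $p_1=1$ and, for $i\ge 2$, $p_i=\min\{1,r\,l_i\}$ with $l_i=\frac{2f_{\varphi_i}(a_i)}{S}+\frac{8}{i-1}$ (the first quotient is read as $0$ if $S=0$); then, independently of the earlier choices, with probability $p_i$ it adds $a_i$ to $C$ with weight $1/p_i$. After the last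 point it returns $C$. **(Accuracy and size.)** For every $\epsilon_0\in(0,1)$ there are constants $c,K>0$, depending only on $\epsilon_0$, such that for all $n\ge 0$, $d,k\ge 1$, all $\epsilon\in(0,\epsilon_0]$ and all $A\in\mathbb{R}^{n\times d}$, the coreset $C$ returned by ParametricFilter with $r=c\,\frac{dk\log(1/\epsilon)}{\epsilon^2}$ satisfies, with probability at least $0.99$, $$|f_X(C)-f_X(A)|\le\epsilon\,\bigl(f_X(A)+f_\varphi(A)\bigr)\qquad\text{for all }X\in\mathbb{R}^{k\times d}\text{ simultaneously.}$$ Moreover, with the same $r$, if $n\ge 2$ and $a_1\ne a_2$, then the expected number of points of $C$ is at most $$K\,\frac{dk\log(1/\epsilon)}{\epsilon^2}\bigl(\log n+\log f_\varphi(A)-\log f_{\varphi_2}(a_2)\bigr).$$ **(Time and space.)** ParametricFilter has update time $O(d)$ and working space $O(d)$: there is one program for the real RAM (unit-cost arithmetic and comparison of reals, one random number uniform in $[0,1]$ per arriving point, and a write-only output tape that holds the coreset and is not counted as working space) and an absolute constant $K'$ such that, for every $d\ge 1$, every $r>0$ and every stream in $\mathbb{R}^d$, the program processes each arriving point in at most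 $K'd$ steps, uses at most $K'd$ real memory cells (besides a fixed number of index registers), and writes exactly the weighted coreset $C$ of ParametricFilter to its output. -/

import Mathlib

open MeasureTheory

noncomputable section

namespace KMeansFilter

/-- Points of `ℝ^d` with the Euclidean norm. -/
abbrev Pt (d : ℕ) : Type := EuclideanSpace ℝ (Fin d)

/-! ### The k-means cost -/

/-- `f_x(a)`: the squared Euclidean distance of `a` to a single centre `x`. -/
def sqDist {d : ℕ} (x a : Pt d) : ℝ := ‖a - x‖ ^ 2

/-- `f_X(a) = min_{x ∈ X} ‖a - x‖²` for a tuple `X` of `k` centres (used for `1 ≤ k`). -/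
def centerCost {d k : ℕ} (X : Fin k → Pt d) (a : Pt d) : ℝ := ⨅ j, sqDist (X j) a

/-- `f_X(A)`. -/
def cost {n d k : ℕ} (X : Fin k → Pt d) (A : Fin n → Pt d) : ℝ := ∑ i, centerCost X (A i)

/-- `f_X(C)` for a list `C` of weighted points. -/
def weightedCost {d k : ℕ} (X : Fin k → Pt d) (C : List (Pt d × ℝ)) : ℝ :=
  (C.map fun c => c.2 * centerCost X c.1).sum

/-- The mean `φ_m` of the first `m` points of `A`. -/
def prefixMean {n d : ℕ} (A : Fin n → Pt d) (m : ℕ) : Pt d :=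
  (m : ℝ)⁻¹ • ∑ j : Fin n with j.val < m, A j

/-- `f_φ(A)`, where `φ` is the mean of all the points of `A`. -/
def meanCost {n d : ℕ} (A : Fin n → Pt d) : ℝ := ∑ i, sqDist (prefixMean A n) (A i)

/-! ### ParametricFilter for squared Euclidean distance (`M_i = I`, `μ_i = 1`) -/

/-- The state of the algorithm between two arrivals. -/
structure FilterState (d : ℕ) where
  /-- the number of points that have arrived -/
  count : ℕ
  /-- the running mean `φ` -/
  mean : Pt d
  /-- the running sum `S` -/
  total : ℝ
  /-- the sampled points with their weights, in order of arrival -/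
  coreset : List (Pt d × ℝ)

/-- The state before the first arrival. -/
def FilterState.init (d : ℕ) : FilterState d := ⟨0, 0, 0, []⟩

/-- The new mean `φ_i = ((i - 1) φ_{i-1} + a_i) / i`; here `i = s.count + 1`. -/
def newMean {d : ℕ} (s : FilterState d) (a : Pt d) : Pt d :=
  ((s.count : ℝ) + 1)⁻¹ • ((s.count : ℝ) • s.mean + a)

/-- The new sum `S + f_{φ_i}(a_i)`. -/
def newTotal {d : ℕ} (s : FilterState d) (a : Pt d) : ℝ :=
  s.total + sqDist (newMean s a) a

/-- The sampling probability: `p_1 = 1`, and for `i = s.count + 1 ≥ 2`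
`p_i = min {1, r l_i}` with `l_i = 2 f_{φ_i}(a_i) / S + 8 / (i - 1)`.
If `S = 0` (all points so far coincide) the quotient `0 / 0` is read as `0`. -/
def sampleProb {d : ℕ} (r : ℝ) (s : FilterState d) (a : Pt d) : ℝ :=
  if s.count = 0 then 1
  else min 1 (r * (2 * sqDist (newMean s a) a / newTotal s a + 8 / (s.count : ℝ)))

/-- One arrival: the point `a` comes with a number `u`, uniform on `[0, 1]`; it is stored with
weight `1 / p_i` exactly when `u ≤ p_i`, that is, with probability `p_i`. -/
def filterStep {d : ℕ} (r : ℝ) (s : FilterState d) (x : Pt d × unitInterval) : FilterState d where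
  count := s.count + 1
  mean := newMean s x.1
  total := newTotal s x.1
  coreset :=
    if (x.2 : ℝ) ≤ sampleProb r s x.1 then s.coreset ++ [(x.1, 1 / sampleProb r s x.1)]
    else s.coreset

/-- The weighted coreset returned after a stream of points, each with its random number. -/
def parametricFilter {d : ℕ} (r : ℝ) (stream : List (Pt d × unitInterval)) : List (Pt d × ℝ) :=
  (stream.foldl (filterStep r) (FilterState.init d)).coreset

/-- The random coreset for `A`; the sample space is `[0, 1]^n` with the uniform measure. -/
def coresetOf {n d : ℕ} (r : ℝ) (A : Fin n → Pt d) (u : Fin n → unitInterval) :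
    List (Pt d × ℝ) :=
  parametricFilter r (List.ofFn fun i => (A i, u i))

/-- The additive guarantee `|f_X(C) - f_X(A)| ≤ ε (f_X(A) + f_φ(A))`, for all `k`-tuples `X`. -/
def IsAdditiveCoreset {n d : ℕ} (k : ℕ) (ε : ℝ) (A : Fin n → Pt d) (C : List (Pt d × ℝ)) : Prop :=
  ∀ X : Fin k → Pt d, |weightedCost X C - cost X A| ≤ ε * (cost X A + meanCost A)

/-! ### A streaming real RAM, for update time and working space

A machine has memory cells that hold real numbers, index registers that hold natural numbers
(a program mentions finitely many of them), and a write-only output tape. At each arrival it may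
read the coordinates of the current point and one random number. Every instruction and every test
costs one step. -/

/-- Address of a memory cell: a fixed one, or a fixed base plus the content of an index register. -/
inductive Addr where
  | direct (b : ℕ)
  | indexed (b x : ℕ)

/-- Arithmetic operations. -/
inductive Op where
  | add
  | sub
  | mul
  | div

/-- Programs. -/
inductive Prog where
  /-- `dst := q` -/
  | const (dst : Addr) (q : ℕ)
  /-- `dst := src₁ o src₂` -/
  | arith (o : Op) (dst src₁ src₂ : Addr)
  /-- `dst :=` the coordinate, of the current point, whose number is in index register `x` -/
  | input (dst : Addr) (x : ℕ)
  /-- `dst :=` the random number of the current arrival -/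
  | rand (dst : Addr)
  /-- append the content of `src` to the output tape -/
  | emit (src : Addr)
  /-- set index register `x` to zero -/
  | idxZero (x : ℕ)
  /-- increment index register `x` -/
  | idxSucc (x : ℕ)
  | seq (c₁ c₂ : Prog)
  /-- if `a ≤ b` then `c₁` else `c₂`, for the contents of two memory cells -/
  | ifLe (a b : Addr) (c₁ c₂ : Prog)
  /-- while index register `x` is less than the dimension do `c` -/
  | whileLtDim (x : ℕ) (c : Prog)

/-- Configuration of the machine. -/
structure Config where
  idx : ℕ → ℕ
  mem : ℕ → ℝ
  out : List ℝ

/-- The cell that an address denotes. -/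
def Addr.cell (s : Config) : Addr → ℕ
  | .direct b => b
  | .indexed b x => b + s.idx x

/-- Content of a cell. -/
def Config.get (s : Config) (a : Addr) : ℝ := s.mem (a.cell s)

/-- Write to a cell. -/
def Config.set (s : Config) (a : Addr) (v : ℝ) : Config :=
  { s with mem := Function.update s.mem (a.cell s) v }

/-- Write to an index register. -/
def Config.setIdx (s : Config) (x v : ℕ) : Config :=
  { s with idx := Function.update s.idx x v }

/-- Value of an arithmetic operation. -/
def Op.eval : Op → ℝ → ℝ → ℝ
  | .add, v, w => v + w
  | .sub, v, w => v - w
  | .mul, v, w => v * w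
  | .div, v, w => v / w

/-- `Exec B p u c s s' t`: on the current point `p` and random number `u`, the program `c` started
in `s` halts in `s'` after exactly `t` steps and accesses only memory cells with address below `B`.
Division by zero has no execution. -/
inductive Exec {d : ℕ} (B : ℕ) (p : Pt d) (u : ℝ) : Prog → Config → Config → ℕ → Prop
  | const {s : Config} {dst : Addr} {q : ℕ} (h : dst.cell s < B) :
      Exec B p u (.const dst q) s (s.set dst q) 1
  | arith {s : Config} {o : Op} {dst a b : Addr} (h : dst.cell s < B)
      (ha : a.cell s < B) (hb : b.cell s < B) (hdiv : o = .div → s.get b ≠ 0) :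
      Exec B p u (.arith o dst a b) s (s.set dst (o.eval (s.get a) (s.get b))) 1
  | input {s : Config} {dst : Addr} {x : ℕ} (h : dst.cell s < B) (hx : s.idx x < d) :
      Exec B p u (.input dst x) s (s.set dst (p ⟨s.idx x, hx⟩)) 1
  | rand {s : Config} {dst : Addr} (h : dst.cell s < B) :
      Exec B p u (.rand dst) s (s.set dst u) 1
  | emit {s : Config} {a : Addr} (ha : a.cell s < B) :
      Exec B p u (.emit a) s { s with out := s.out ++ [s.get a] } 1
  | idxZero {s : Config} {x : ℕ} : Exec B p u (.idxZero x) s (s.setIdx x 0) 1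
  | idxSucc {s : Config} {x : ℕ} : Exec B p u (.idxSucc x) s (s.setIdx x (s.idx x + 1)) 1
  | seq {s s₁ s₂ : Config} {c₁ c₂ : Prog} {t₁ t₂ : ℕ}
      (h₁ : Exec B p u c₁ s s₁ t₁) (h₂ : Exec B p u c₂ s₁ s₂ t₂) :
      Exec B p u (.seq c₁ c₂) s s₂ (t₁ + t₂)
  | ifTrue {s s₁ : Config} {a b : Addr} {c₁ c₂ : Prog} {t : ℕ}
      (ha : a.cell s < B) (hb : b.cell s < B) (hab : s.get a ≤ s.get b)
      (h : Exec B p u c₁ s s₁ t) : Exec B p u (.ifLe a b c₁ c₂) s s₁ (t + 1)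
  | ifFalse {s s₁ : Config} {a b : Addr} {c₁ c₂ : Prog} {t : ℕ}
      (ha : a.cell s < B) (hb : b.cell s < B) (hab : ¬ s.get a ≤ s.get b)
      (h : Exec B p u c₂ s s₁ t) : Exec B p u (.ifLe a b c₁ c₂) s s₁ (t + 1)
  | whileStop {s : Config} {x : ℕ} {c : Prog} (hx : ¬ s.idx x < d) :
      Exec B p u (.whileLtDim x c) s s 1
  | whileStep {s s₁ s₂ : Config} {x : ℕ} {c : Prog} {t₁ t₂ : ℕ} (hx : s.idx x < d)
      (h₁ : Exec B p u c s s₁ t₁) (h₂ : Exec B p u (.whileLtDim x c) s₁ s₂ t₂) :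
      Exec B p u (.whileLtDim x c) s s₂ (t₁ + t₂ + 1)

/-- The stream is processed online by running the same program `c` once at each arrival, each time
in at most `T` steps and on at most `B` memory cells, the configuration being kept in between. -/
inductive RunsOnline {d : ℕ} (B T : ℕ) (c : Prog) :
    Config → List (Pt d × unitInterval) → Config → Prop
  | nil {s : Config} : RunsOnline B T c s [] s
  | cons {s s₁ s₂ : Config} {p : Pt d} {u : unitInterval} {l : List (Pt d × unitInterval)} {t : ℕ}
      (h : Exec B p (u : ℝ) c s s₁ t) (ht : t ≤ T) (hl : RunsOnline B T c s₁ l s₂) :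
      RunsOnline B T c s ((p, u) :: l) s₂

/-- Initially cell `0` holds the parameter `r`; everything else is zero or empty. -/
def Config.start (r : ℝ) : Config := ⟨fun _ => 0, fun m => if m = 0 then r else 0, []⟩

/-- A weighted coreset as an output tape: for each point its coordinates, then its weight. -/
def encode {d : ℕ} (C : List (Pt d × ℝ)) : List ℝ :=
  C.flatMap fun c => (List.ofFn fun j : Fin d => c.1 j) ++ [c.2]

end KMeansFilter

end

namespace KMeansFilter

/-! ### Nets of Euclidean balls -/

/-! Sampling. The running mean and the sum `S` do not depend on the random choices, so the points
are kept independently with fixed probabilities `streamProb`. These dominate `r` times the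
sensitivities (`centerCost_le_sensitivity`): a point costs at most twice its distance term to `φ_i`
plus twice the cost of `φ_i`. The former is charged to `S`, which never exceeds `f_φ(A)` because
means are optimal; the latter is an average over the points seen so far. For one fixed `X` a
Chernoff bound then gives failure probability `2 exp (-r e² / 4)` (`measureReal_deviation_gt_le`).

Uniformity in `X`. A net is needed whose logarithm is `O(d k log (1/e))`, free of `n` and of `log
k`. Let `σ` be the root mean square distance of the points to their mean `c`, and let `ρ = 3 / e`.
If every centre is at distance at least `ρ σ` from `c`, all points cost nearly the same and only the
total weight matters (`abs_sum_centerCost_le_of_far`). Otherwise some centre `X j₀` is near `c`. Cut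
space into shells of ratio `ρ` around `c`. A centre in shell `s` matters only to points in the
window of shells `s - 1, s, s + 1`: points farther in prefer `X j₀`, and points farther out hardly
distinguish the centre from `X j₀`. So centres whose window carries little cost may be moved to the
rounded `X j₀`, and the others are rounded to a net of their shell.

Windows overlap at most three times, so only `O(k / e)` shells are heavy, and the net has `O(k / e)
(1 + 18 / e³)^d` points. Counting its subsets of size at most `k`, not its `k`-tuples, divides the
base by `k` and removes `log k`. The at most `k` light windows are controlled by a second moment
summed over all windows, which avoids a union bound over the unboundedly many shells
(`measureReal_window_le`). `IsSensitivitySampling.le_measureReal` combines these events.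

Size. The expected size is the sum of the probabilities; the terms `2 f / S` and `8 / (i - 1)`
telescope into logarithms (`sum_streamProb_le`). Time and space. An explicit program, verified by
weakest preconditions and a loop invariant, updates the mean in place, coordinate by coordinate. -/

theorem card_le_of_separated {d : ℕ} {R δ : ℝ} (hR : 0 ≤ R) (hδ : 0 < δ) (c : Pt d)
    (s : Finset (Pt d)) (hs : ∀ x ∈ s, ‖x - c‖ ≤ R)
    (hsep : ∀ x ∈ s, ∀ y ∈ s, x ≠ y → δ ≤ ‖x - y‖) :
    (s.card : ℝ) ≤ (1 + 2 * R / δ) ^ d := by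
  have hρ : 0 < R + δ / 2 := by positivity
  have hδ2 : 0 < δ / 2 := by positivity
  -- Disjoint balls of radius `δ / 2` fit into the ball of radius `R + δ / 2`; compare volumes.
  have hdisj : Set.Pairwise (s : Set (Pt d)) (Function.onFun Disjoint
      fun x => Metric.ball (x : Pt d) (δ / 2)) := by
    intro x hx y hy hxy
    apply Metric.ball_disjoint_ball
    rw [dist_eq_norm]
    linarith [hsep x hx y hy hxy]
  have hsub : (⋃ x ∈ s, Metric.ball (x : Pt d) (δ / 2)) ⊆ Metric.ball c (R + δ / 2) := by
    refine Set.iUnion₂_subset fun x hx => Metric.ball_subset_ball' ?_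
    rw [dist_eq_norm]
    linarith [hs x hx]
  have hfin : Module.finrank ℝ (Pt d) = d := by simp
  have h1 : (s.card : ENNReal) * ENNReal.ofReal ((δ / 2) ^ d) * volume (Metric.ball (0 : Pt d) 1) ≤
      ENNReal.ofReal ((R + δ / 2) ^ d) * volume (Metric.ball (0 : Pt d) 1) := by
    calc _ = volume (⋃ x ∈ s, Metric.ball (x : Pt d) (δ / 2)) := by
          rw [measure_biUnion_finset hdisj fun c _ => measurableSet_ball]
          simp only [Measure.addHaar_ball_of_pos _ _ hδ2, hfin, Finset.sum_const, nsmul_eq_mul,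
            mul_assoc]
      _ ≤ volume (Metric.ball c (R + δ / 2)) := measure_mono hsub
      _ = _ := by rw [Measure.addHaar_ball_of_pos _ _ hρ, hfin]
  have h2 : (s.card : ENNReal) * ENNReal.ofReal ((δ / 2) ^ d) ≤
      ENNReal.ofReal ((R + δ / 2) ^ d) :=
    (ENNReal.mul_le_mul_iff_left (Metric.measure_ball_pos _ _ zero_lt_one).ne'
      measure_ball_lt_top.ne).1 h1
  have h3 := ENNReal.toReal_le_of_le_ofReal (by positivity) h2
  rw [ENNReal.toReal_mul, ENNReal.toReal_natCast, ENNReal.toReal_ofReal (by positivity)] at h3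
  have h4 : (1 + 2 * R / δ) = (R + δ / 2) / (δ / 2) := by field_simp; ring
  rw [h4, div_pow, le_div_iff₀ (by positivity)]
  exact h3

/-- A `δ`-separated subset of the ball of largest size is a net, since a point missed by it could be
added. The volume bound ensures that a largest size exists. -/
theorem exists_ball_net {d : ℕ} {R δ : ℝ} (hR : 0 ≤ R) (hδ : 0 < δ) (c : Pt d) :
    ∃ N : Finset (Pt d), (N.card : ℝ) ≤ (1 + 2 * R / δ) ^ d ∧
      ∀ x, ‖x - c‖ ≤ R → ∃ y ∈ N, ‖x - y‖ ≤ δ := by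
  classical
  let S : Set ℕ := {m | ∃ s : Finset (Pt d), s.card = m ∧ (∀ x ∈ s, ‖x - c‖ ≤ R) ∧
    ∀ x ∈ s, ∀ y ∈ s, x ≠ y → δ ≤ ‖x - y‖}
  have hne : S.Nonempty := ⟨0, ∅, by simp⟩
  have hbdd : BddAbove S := by
    refine ⟨⌊(1 + 2 * R / δ) ^ d⌋₊, ?_⟩
    rintro _ ⟨s, rfl, h1, h2⟩
    exact Nat.le_floor (card_le_of_separated hR hδ c s h1 h2)
  obtain ⟨s, hs, h1, h2⟩ := Nat.sSup_mem hne hbdd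
  refine ⟨s, card_le_of_separated hR hδ c s h1 h2, fun x hx => ?_⟩
  by_contra! hcon
  have hxs : x ∉ s := fun h => by
    have := hcon x h
    simp at this
    linarith
  have hmem : (insert x s).card ∈ S := by
    refine ⟨insert x s, rfl, ?_, ?_⟩
    · intro y hy
      rcases Finset.mem_insert.1 hy with rfl | hy
      · exact hx
      · exact h1 y hy
    · intro y hy z hz hyz
      rcases Finset.mem_insert.1 hy with rfl | hy' <;> rcases Finset.mem_insert.1 hz with rfl | hz'
      · exact absurd rfl hyz
      · exact (hcon z hz').le
      · rw [norm_sub_rev]; exact (hcon y hy').le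
      · exact h2 y hy' z hz' hyz
  have := le_csSup hbdd hmem
  rw [Finset.card_insert_of_notMem hxs, hs] at this
  omega

/-- The number of subsets with at most `k` elements of a set with at most `B` elements. -/
theorem card_small_subsets_le {α : Type*} [DecidableEq α] (P : Finset α) {k : ℕ} {B : ℝ}
    (hk : 1 ≤ k) (hkB : (k : ℝ) ≤ B) (hP : (P.card : ℝ) ≤ B) :
    ((P.powerset.filter fun T => T.card ≤ k).card : ℝ) ≤ (Real.exp 1 * (B / k)) ^ k := by
  have hk0 : (0 : ℝ) < k := by exact_mod_cast hk
  have hB : 0 < B := by linarith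
  -- Give each subset `T` the weight `x ^ T.card`. All subsets together weigh `(x + 1) ^ P.card ≤
  -- exp k`, while each one counted here weighs at least `x ^ k`.
  set x : ℝ := k / B with hx
  have hx0 : 0 < x := by positivity
  have hx1 : x ≤ 1 := by rw [hx, div_le_one hB]; exact hkB
  have h1 : ((P.powerset.filter fun T => T.card ≤ k).card : ℝ) * x ^ k ≤ (x + 1) ^ P.card := by
    rw [← Finset.sum_pow_mul_eq_add_pow x 1 P, ← nsmul_eq_mul, ← Finset.sum_const]
    calc _ ≤ ∑ T ∈ P.powerset.filter (fun T => T.card ≤ k), x ^ T.card * 1 ^ (P.card - T.card) := by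
          refine Finset.sum_le_sum fun T hT => ?_
          rw [one_pow, mul_one]
          exact pow_le_pow_of_le_one hx0.le hx1 (Finset.mem_filter.1 hT).2
      _ ≤ _ := Finset.sum_le_sum_of_subset_of_nonneg (Finset.filter_subset _ _)
          fun T _ _ => by positivity
  have h2 : (x + 1) ^ P.card ≤ Real.exp 1 ^ k := by
    calc (x + 1) ^ P.card ≤ Real.exp x ^ P.card :=
          pow_le_pow_left₀ (by positivity) (Real.add_one_le_exp x) _
      _ = Real.exp (P.card * x) := by rw [← Real.exp_nat_mul]
      _ ≤ Real.exp (k * 1) := by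
          apply Real.exp_le_exp.2
          calc (P.card : ℝ) * x ≤ B * x := by gcongr
            _ = k * 1 := by rw [hx]; field_simp
      _ = _ := by rw [Real.exp_nat_mul]
  have h3 : (B / k) = x⁻¹ := by rw [hx, inv_div]
  rw [h3, mul_pow, inv_pow, ← div_eq_mul_inv, le_div_iff₀ (by positivity)]
  exact h1.trans h2

/-! ### Independent sampling -/

/-- The weight of a point that is kept, with weight `1 / p`, when `u ≤ p`. -/
noncomputable def sampleWeight (p : ℝ) (u : unitInterval) : ℝ := if (u : ℝ) ≤ p then 1 / p else 0

theorem sampleWeight_nonneg {p : ℝ} (hp : 0 < p) (u : unitInterval) : 0 ≤ sampleWeight p u := by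
  unfold sampleWeight; split_ifs <;> positivity

theorem measurable_sampleWeight (p : ℝ) : Measurable (sampleWeight p) :=
  Measurable.ite (measurableSet_le measurable_subtype_coe measurable_const) measurable_const
    measurable_const

theorem integral_comp_threshold {p : ℝ} (hp : 0 ≤ p) (hp1 : p ≤ 1) (α β : ℝ) :
    ∫ u : unitInterval, (if (u : ℝ) ≤ p then α else β) = p * α + (1 - p) * β := by
  have hset : {u : unitInterval | (u : ℝ) ≤ p} = Set.Iic ⟨p, hp, hp1⟩ := by
    ext u; simp [← Subtype.coe_le_coe]
  have hvol : (volume : Measure unitInterval).real {u : unitInterval | (u : ℝ) ≤ p} = p := by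
    rw [hset, Measure.real, unitInterval.volume_Iic, ENNReal.toReal_ofReal hp]
  have hm : MeasurableSet {u : unitInterval | (u : ℝ) ≤ p} :=
    measurableSet_le measurable_subtype_coe measurable_const
  have hdec : ∀ u : unitInterval, (if (u : ℝ) ≤ p then α else β) =
      Set.indicator {u : unitInterval | (u : ℝ) ≤ p} (fun _ => α - β) u + β := by
    intro u
    by_cases h : (u : ℝ) ≤ p <;> simp [Set.indicator, h]
  simp_rw [hdec]
  rw [integral_add ((integrable_const _).indicator hm) (integrable_const _),
    integral_indicator_const _ hm, hvol]
  simp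
  ring

theorem exp_le_one_add_add_sq {x : ℝ} (hx : |x| ≤ 1) : Real.exp x ≤ 1 + x + x ^ 2 := by
  have := Real.abs_exp_sub_one_sub_id_le hx
  linarith [(abs_le.1 this).2]

/-- For `p = 1` the weight is constantly `1`. Otherwise `|y| ≤ p` keeps both exponents in `[-1, 1]`,
where `exp x ≤ 1 + x + x²`; the linear terms cancel because the weight has mean `1`, and its
variance is `(1 - p) / p`. -/
theorem integral_exp_sampleWeight_le {p y : ℝ} (hp : 0 < p) (hp1 : p ≤ 1)
    (hy : p = 1 ∨ |y| ≤ p) :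
    ∫ u : unitInterval, Real.exp (y * (sampleWeight p u - 1)) ≤
      Real.exp (y ^ 2 * ((1 - p) / p)) := by
  have hdec : ∀ u : unitInterval, Real.exp (y * (sampleWeight p u - 1)) =
      if (u : ℝ) ≤ p then Real.exp (y * (1 / p - 1)) else Real.exp (-y) := by
    intro u
    unfold sampleWeight
    split_ifs
    · rfl
    · congr 1; ring
  simp_rw [hdec]
  rw [integral_comp_threshold hp.le hp1]
  rcases hy with rfl | hy
  · simp
  have h1 : |y * (1 / p - 1)| ≤ 1 := by
    have : 1 / p - 1 = (1 - p) / p := by field_simp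
    rw [this, abs_mul, abs_of_nonneg (div_nonneg (by linarith) hp.le)]
    calc |y| * ((1 - p) / p) ≤ p * ((1 - p) / p) := by
          gcongr
      _ = 1 - p := by field_simp
      _ ≤ 1 := by linarith
  have h2 : |-y| ≤ 1 := by rw [abs_neg]; linarith
  calc _ ≤ p * (1 + y * (1 / p - 1) + (y * (1 / p - 1)) ^ 2) + (1 - p) * (1 + -y + (-y) ^ 2) := by
        gcongr
        · exact exp_le_one_add_add_sq h1
        · exact exp_le_one_add_add_sq h2
    _ = y ^ 2 * ((1 - p) / p) + 1 := by field_simp; ring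
    _ ≤ _ := Real.add_one_le_exp _

section Deviation

variable {n : ℕ}

/-- The deviation `∑ bᵢ (wᵢ - 1)` of a weighted sample from `∑ bᵢ`. -/
noncomputable def deviation (p b : Fin n → ℝ) (u : Fin n → unitInterval) : ℝ :=
  ∑ i, b i * (sampleWeight (p i) (u i) - 1)

theorem measurable_deviation (p b : Fin n → ℝ) : Measurable (deviation p b) := by
  unfold deviation
  refine Finset.measurable_sum _ fun i _ => ?_
  exact (((measurable_sampleWeight (p i)).comp (measurable_pi_apply i)).sub_const 1).const_mul _

theorem exists_abs_deviation_le (p b : Fin n → ℝ) : ∃ B, ∀ u, |deviation p b u| ≤ B := by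
  refine ⟨∑ i, |b i| * (|1 / p i| + 1), fun u => ?_⟩
  refine (Finset.abs_sum_le_sum_abs _ _).trans (Finset.sum_le_sum fun i _ => ?_)
  rw [abs_mul]
  gcongr
  refine (abs_sub _ _).trans ?_
  rw [abs_one]
  refine add_le_add_left ?_ 1
  unfold sampleWeight
  split_ifs
  · exact le_rfl
  · rw [abs_zero]; positivity

theorem integrable_comp_deviation (p b : Fin n → ℝ) {g : ℝ → ℝ} (hg : Continuous g) :
    Integrable (fun u => g (deviation p b u)) := by
  obtain ⟨B, hB⟩ := exists_abs_deviation_le p b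
  obtain ⟨C, hC⟩ := (isCompact_Icc (a := -B) (b := B)).exists_bound_of_continuousOn hg.continuousOn
  refine Integrable.of_bound
    (hg.measurable.comp (measurable_deviation p b)).aestronglyMeasurable C ?_
  exact Filter.Eventually.of_forall fun u => hC _ (abs_le.1 (hB u))

/-- Independence factors the integral. The domination `r b_i ≤ p_i G` serves twice: it gives `|y
b_i| ≤ p_i`, and it bounds the variance `b_i² (1 - p_i) / p_i` by `G b_i / r`. -/
theorem integral_exp_deviation_le {p b : Fin n → ℝ} {r G y : ℝ} (hr : 0 < r) (hG : 0 ≤ G)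
    (hp : ∀ i, 0 < p i) (hp1 : ∀ i, p i ≤ 1) (hb : ∀ i, 0 ≤ b i)
    (hbG : ∀ i, p i = 1 ∨ r * b i ≤ p i * G) (hy : |y| * G ≤ r) :
    ∫ u, Real.exp (y * deviation p b u) ≤ Real.exp (y ^ 2 * (G * (∑ i, b i) / r)) := by
  have hprod : ∀ u, Real.exp (y * deviation p b u) =
      ∏ i, Real.exp (y * b i * (sampleWeight (p i) (u i) - 1)) := by
    intro u
    rw [← Real.exp_sum, deviation, Finset.mul_sum]
    simp only [mul_assoc]
  simp_rw [hprod]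
  rw [integral_fintype_prod_volume_eq_prod
    (fun i (v : unitInterval) => Real.exp (y * b i * (sampleWeight (p i) v - 1)))]
  calc _ ≤ ∏ i, Real.exp (y ^ 2 * (G * b i / r)) := by
        refine Finset.prod_le_prod (fun i _ => integral_nonneg fun _ => (Real.exp_pos _).le)
          fun i _ => ?_
        have hpi := hp i
        refine (integral_exp_sampleWeight_le hpi (hp1 i) ?_).trans (Real.exp_le_exp.2 ?_)
        · rcases hbG i with h | h
          · exact Or.inl h
          · right
            rw [abs_mul, abs_of_nonneg (hb i)]
            have : r * (|y| * b i) ≤ r * p i := by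
              calc r * (|y| * b i) = |y| * (r * b i) := by ring
                _ ≤ |y| * (p i * G) := by gcongr
                _ = |y| * G * p i := by ring
                _ ≤ r * p i := by gcongr
            exact le_of_mul_le_mul_left this hr
        · rw [mul_pow, mul_assoc]
          refine mul_le_mul_of_nonneg_left ?_ (sq_nonneg y)
          rcases hbG i with h | h
          · rw [h, sub_self, zero_div, mul_zero]
            have := hb i
            positivity
          · rw [mul_div_assoc', div_le_div_iff₀ hpi hr]
            calc b i ^ 2 * (1 - p i) * r ≤ b i ^ 2 * 1 * r := by
                  have := hb i
                  gcongr
                  linarith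
              _ = b i * (r * b i) := by ring
              _ ≤ b i * (p i * G) := by gcongr; exact hb i
              _ = G * b i * p i := by ring
    _ = _ := by
        rw [← Real.exp_sum, ← Finset.mul_sum, ← Finset.sum_div, ← Finset.mul_sum]

theorem measureReal_deviation_gt_le {p b : Fin n → ℝ} {r G e : ℝ} (hr : 0 < r) (hG : 0 < G)
    (he : 0 ≤ e) (he1 : e ≤ 1)
    (hp : ∀ i, 0 < p i) (hp1 : ∀ i, p i ≤ 1) (hb : ∀ i, 0 ≤ b i)
    (hbG : ∀ i, p i = 1 ∨ r * b i ≤ p i * G) (hsum : ∑ i, b i ≤ G) :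
    (volume : Measure (Fin n → unitInterval)).real {u | e * G < |deviation p b u|} ≤
      2 * Real.exp (-(r * e ^ 2 / 4)) := by
  -- The minimiser of the Chernoff exponent `y² G² / r - y e G`; it is admissible because `e ≤ 1`.
  set y : ℝ := r * e / (2 * G) with hy
  have hy0 : 0 ≤ y := by positivity
  have hyG : y * G = r * e / 2 := by rw [hy]; field_simp
  have hyr : y * G ≤ r := by rw [hyG]; nlinarith
  have hmgf : ∀ z : ℝ, |z| = y →
      ProbabilityTheory.mgf (deviation p b) volume z ≤ Real.exp (r * e ^ 2 / 4) := by
    intro z hz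
    refine (integral_exp_deviation_le hr hG.le hp hp1 hb hbG (by rw [hz]; exact hyr)).trans
      (Real.exp_le_exp.2 ?_)
    calc z ^ 2 * (G * (∑ i, b i) / r) = y ^ 2 * (G * (∑ i, b i) / r) := by rw [← hz, sq_abs]
      _ ≤ y ^ 2 * (G * G / r) := by gcongr
      _ = (y * G) ^ 2 / r := by ring
      _ = r * e ^ 2 / 4 := by rw [hyG]; field_simp; ring
  have hexp : Real.exp (-y * (e * G)) * Real.exp (r * e ^ 2 / 4) =
      Real.exp (-(r * e ^ 2 / 4)) := by
    rw [← Real.exp_add]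
    congr 1
    linear_combination (-e) * hyG
  have h1 := ProbabilityTheory.measure_ge_le_exp_mul_mgf (μ := volume) (X := deviation p b)
    (e * G) hy0 (integrable_comp_deviation p b (g := fun x => Real.exp (y * x)) (by fun_prop))
  have h2 := ProbabilityTheory.measure_le_le_exp_mul_mgf (μ := volume) (X := deviation p b)
    (-(e * G)) (neg_nonpos.2 hy0)
    (integrable_comp_deviation p b (g := fun x => Real.exp (-y * x)) (by fun_prop))
  have h1' := h1.trans (mul_le_mul_of_nonneg_left (hmgf y (abs_of_nonneg hy0)) (Real.exp_pos _).le)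
  have h2' := h2.trans (mul_le_mul_of_nonneg_left
    (hmgf (-y) (by rw [abs_neg, abs_of_nonneg hy0])) (Real.exp_pos _).le)
  rw [hexp] at h1'
  rw [show - -y * -(e * G) = -y * (e * G) by ring, hexp] at h2'
  have hsub : {u | e * G < |deviation p b u|} ⊆
      {u | e * G ≤ deviation p b u} ∪ {u | deviation p b u ≤ -(e * G)} := by
    intro u hu
    rcases lt_abs.1 (show e * G < |deviation p b u| from hu) with h | h
    · exact Or.inl h.le
    · exact Or.inr (show deviation p b u ≤ -(e * G) by linarith)
  calc _ ≤ _ := measureReal_mono hsub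
    _ ≤ _ := measureReal_union_le _ _
    _ ≤ _ := by linarith

theorem sq_le_exp_add_exp_neg_sub_two (x : ℝ) : x ^ 2 ≤ Real.exp x + Real.exp (-x) - 2 := by
  have h1 : |x / 2| ≤ |Real.sinh (x / 2)| := by
    rw [Real.abs_sinh]
    exact Real.self_le_sinh_iff.2 (abs_nonneg _)
  have h2 := sq_le_sq.2 h1
  have h3 : Real.cosh x = Real.cosh (x / 2) ^ 2 + Real.sinh (x / 2) ^ 2 := by
    rw [← Real.cosh_two_mul]; congr 1; ring
  rw [Real.cosh_sq, Real.cosh_eq] at h3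
  linarith

/-- The second moment is read off the exponential moments at `±1 / G`. Keeping `∑ b` as one factor,
and not bounding it by `G`, is what later lets these bounds be summed over windows. -/
theorem integral_sq_deviation_le {p b : Fin n → ℝ} {r G : ℝ} (hr : 1 ≤ r) (hG : 0 < G)
    (hp : ∀ i, 0 < p i) (hp1 : ∀ i, p i ≤ 1) (hb : ∀ i, 0 ≤ b i)
    (hbG : ∀ i, p i = 1 ∨ r * b i ≤ p i * G) (hsum : ∑ i, b i ≤ G) :
    ∫ u, deviation p b u ^ 2 ≤ 4 * G * (∑ i, b i) / r := by
  have hr0 : 0 < r := by linarith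
  set B := ∑ i, b i with hB
  have hB0 : 0 ≤ B := Finset.sum_nonneg fun i _ => hb i
  set z : ℝ := G⁻¹ ^ 2 * (G * B / r) with hz
  have hz' : z = B / (G * r) := by rw [hz]; field_simp
  have hz0 : 0 ≤ z := by positivity
  have hz1 : z ≤ 1 := by
    rw [hz', div_le_one (by positivity)]
    nlinarith
  have h1 := integral_exp_deviation_le (y := G⁻¹) hr0 hG.le hp hp1 hb hbG
    (by rw [abs_of_pos (by positivity), inv_mul_cancel₀ hG.ne']; exact hr)
  have h2 := integral_exp_deviation_le (y := -G⁻¹) hr0 hG.le hp hp1 hb hbG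
    (by rw [abs_neg, abs_of_pos (by positivity), inv_mul_cancel₀ hG.ne']; exact hr)
  rw [neg_sq] at h2
  have hez := exp_le_one_add_add_sq (x := z) (by rw [abs_of_nonneg hz0]; exact hz1)
  have hi1 := integrable_comp_deviation p b (g := fun x => Real.exp (G⁻¹ * x)) (by fun_prop)
  have hi2 := integrable_comp_deviation p b (g := fun x => Real.exp (-G⁻¹ * x)) (by fun_prop)
  have h3 : ∫ u, (G⁻¹ * deviation p b u) ^ 2 ≤
      ∫ u, (Real.exp (G⁻¹ * deviation p b u) + Real.exp (-G⁻¹ * deviation p b u) - 2) := by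
    refine integral_mono
      (integrable_comp_deviation p b (g := fun x => (G⁻¹ * x) ^ 2) (by fun_prop))
      ((hi1.add hi2).sub (integrable_const _)) fun u => ?_
    have := sq_le_exp_add_exp_neg_sub_two (G⁻¹ * deviation p b u)
    simpa [neg_mul] using this
  rw [integral_sub (by exact hi1.add hi2) (integrable_const _), integral_add hi1 hi2] at h3
  simp only [mul_pow, integral_const_mul, integral_const, probReal_univ, smul_eq_mul, one_mul] at h3
  have h4 : G⁻¹ ^ 2 * ∫ u, deviation p b u ^ 2 ≤ 4 * z := by nlinarith
  have h5 : G⁻¹ ^ 2 * ∫ u, deviation p b u ^ 2 ≤ G⁻¹ ^ 2 * (4 * G * B / r) := by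
    refine h4.trans_eq ?_
    rw [hz]; ring
  exact le_of_mul_le_mul_left h5 (by positivity)

end Deviation

/-! ### Perturbation of the cost -/

section Geometry

variable {n d k : ℕ}

theorem sqDist_nonneg (x a : Pt d) : 0 ≤ sqDist x a := sq_nonneg _

theorem centerCost_le (X : Fin k → Pt d) (a : Pt d) (j : Fin k) :
    centerCost X a ≤ ‖a - X j‖ ^ 2 :=
  ciInf_le (Set.finite_range fun j => sqDist (X j) a).bddBelow j

theorem exists_centerCost_eq (hk : 1 ≤ k) (X : Fin k → Pt d) (a : Pt d) :
    ∃ j, centerCost X a = ‖a - X j‖ ^ 2 := by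
  have : Nonempty (Fin k) := ⟨⟨0, hk⟩⟩
  obtain ⟨j, hj⟩ := exists_eq_ciInf_of_finite (f := fun j => sqDist (X j) a)
  exact ⟨j, hj.symm⟩

theorem centerCost_nonneg (X : Fin k → Pt d) (a : Pt d) : 0 ≤ centerCost X a :=
  Real.iInf_nonneg fun _ => sqDist_nonneg _ _

theorem cost_nonneg (X : Fin k → Pt d) (A : Fin n → Pt d) : 0 ≤ cost X A :=
  Finset.sum_nonneg fun _ _ => centerCost_nonneg _ _

theorem meanCost_nonneg (A : Fin n → Pt d) : 0 ≤ meanCost A :=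
  Finset.sum_nonneg fun _ _ => sqDist_nonneg _ _

theorem centerCost_congr_range {X Y : Fin k → Pt d} (h : Set.range X = Set.range Y) :
    centerCost X = centerCost Y := by
  funext a
  have hr : ∀ Z : Fin k → Pt d, centerCost Z a = sInf ((fun x => sqDist x a) '' Set.range Z) := by
    intro Z
    rw [← Set.range_comp]
    rfl
  rw [hr, hr, h]

theorem centerCost_le_two_mul (hk : 1 ≤ k) (X : Fin k → Pt d) (a b : Pt d) :
    centerCost X a ≤ 2 * centerCost X b + 2 * ‖a - b‖ ^ 2 := by
  obtain ⟨j, hj⟩ := exists_centerCost_eq hk X b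
  have h1 := centerCost_le X a j
  have h2 : ‖a - X j‖ ≤ ‖a - b‖ + ‖b - X j‖ := norm_sub_le_norm_sub_add_norm_sub _ _ _
  rw [hj]
  nlinarith [norm_nonneg (a - X j), sq_nonneg (‖a - b‖ - ‖b - X j‖)]

/-- The cross term `2 h D` is split by the arithmetic-geometric mean inequality with parameter `e`.
-/
theorem abs_sq_sub_sq_le {g h D e : ℝ} (hg : 0 ≤ g) (hh : 0 ≤ h) (he : 0 < e)
    (h1 : g ≤ h + D) (h2 : h ≤ g + D) :
    |g ^ 2 - h ^ 2| ≤ e * h ^ 2 + (1 + 1 / e) * D ^ 2 := by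
  have hD : 0 ≤ D := by linarith
  have hamgm : 2 * h * D ≤ e * h ^ 2 + 1 / e * D ^ 2 := by
    have : 0 ≤ (e * h - D) ^ 2 / e := by positivity
    have h3 : (e * h - D) ^ 2 / e = e * h ^ 2 + 1 / e * D ^ 2 - 2 * h * D := by field_simp; ring
    linarith
  rw [abs_le]
  constructor
  · rcases le_total h g with h3 | h3
    · have : h ^ 2 ≤ g ^ 2 := by gcongr
      have : 0 ≤ 2 * h * D := by positivity
      nlinarith [sq_nonneg D]
    · nlinarith [sq_nonneg D, mul_nonneg (sub_nonneg.2 h3) hg, mul_nonneg hh hD]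
  · nlinarith

/-- If every centre of `X` can be exchanged for one of `Y` at an additional distance `D`, and
conversely, then the costs of `a` are close. -/
theorem abs_centerCost_sub_le (hk : 1 ≤ k) {X Y : Fin k → Pt d} {a b : Pt d} {e D : ℝ}
    (he : 0 < e) (hXY : ∀ j, ∃ j', ‖b - Y j'‖ ≤ ‖a - X j‖ + D)
    (hYX : ∀ j, ∃ j', ‖a - X j'‖ ≤ ‖b - Y j‖ + D) :
    |centerCost X a - centerCost Y b| ≤ e * centerCost Y b + (1 + 1 / e) * D ^ 2 := by
  obtain ⟨j₁, h₁⟩ := exists_centerCost_eq hk X a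
  obtain ⟨j₂, h₂⟩ := exists_centerCost_eq hk Y b
  obtain ⟨i₂, hi₂⟩ := hXY j₁
  obtain ⟨i₁, hi₁⟩ := hYX j₂
  have h3 : ‖a - X j₁‖ ≤ ‖a - X i₁‖ :=
    (sq_le_sq₀ (norm_nonneg _) (norm_nonneg _)).1 (h₁ ▸ centerCost_le X a i₁)
  have h4 : ‖b - Y j₂‖ ≤ ‖b - Y i₂‖ :=
    (sq_le_sq₀ (norm_nonneg _) (norm_nonneg _)).1 (h₂ ▸ centerCost_le Y b i₂)
  rw [h₁, h₂]
  exact abs_sq_sub_sq_le (norm_nonneg _) (norm_nonneg _) he (h3.trans hi₁) (h4.trans hi₂)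

/-! ### Shells around a point -/

/-- The index of the shell, between radii `ρ ^ s * σ` and `ρ ^ (s + 1) * σ` around `c`, that
contains `x`; the shell with index `0` is a ball. -/
noncomputable def shell (ρ σ : ℝ) (c x : Pt d) : ℕ := sInf {s | ‖x - c‖ < ρ ^ (s + 1) * σ}

theorem norm_sub_lt_of_shell {ρ σ : ℝ} (hρ : 1 < ρ) (hσ : 0 < σ) (c x : Pt d) :
    ‖x - c‖ < ρ ^ (shell ρ σ c x + 1) * σ := by
  have hne : {s : ℕ | ‖x - c‖ < ρ ^ (s + 1) * σ}.Nonempty := by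
    obtain ⟨m, hm⟩ := pow_unbounded_of_one_lt (‖x - c‖ / σ) hρ
    refine ⟨m, ?_⟩
    rw [div_lt_iff₀ hσ] at hm
    refine hm.trans_le ?_
    gcongr
    · exact hρ.le
    · omega
  exact Nat.sInf_mem hne

theorem le_norm_sub_of_shell {ρ σ : ℝ} (c x : Pt d) (h : 1 ≤ shell ρ σ c x) :
    ρ ^ (shell ρ σ c x) * σ ≤ ‖x - c‖ := by
  have h1 : shell ρ σ c x - 1 < shell ρ σ c x := by omega
  have h2 := Nat.notMem_of_lt_sInf h1
  simp only [Set.mem_ofPred_eq, not_lt] at h2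
  rwa [Nat.sub_add_cancel h] at h2

theorem shell_eq_zero {ρ σ : ℝ} {c x : Pt d} (h : ‖x - c‖ < ρ * σ) : shell ρ σ c x = 0 := by
  apply Nat.sInf_eq_zero.2
  left
  simpa using h

/-- `Y` arises from `X` by moving the centres in the shells of `L` to the position of the centre
`j₀`, which is near `c`, and by rounding the others. -/
structure IsRounding (ρ σ e : ℝ) (c : Pt d) (L : Set ℕ) (j₀ : Fin k) (X Y : Fin k → Pt d) :
    Prop where
  near : ‖X j₀ - c‖ < ρ * σ
  moved : ∀ j, shell ρ σ c (X j) ∈ L → Y j = Y j₀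
  -- The division by `ρ` is there because the centre may also serve points one shell farther in,
  -- where only this smaller error is affordable.
  rounded : ∀ j, shell ρ σ c (X j) ∉ L → ‖X j - Y j‖ ≤ e * (ρ ^ shell ρ σ c (X j) * σ / ρ)

theorem mul_div_le_mul {ρ σ e : ℝ} (hσ : 0 < σ) (he1 : e ≤ 1 / 2) (hρ : 6 ≤ ρ) :
    e * (σ / ρ) ≤ ρ * σ := by
  have h1 : σ / ρ ≤ σ := div_le_self hσ.le (by linarith)
  have h2 : 0 ≤ σ / ρ := by positivity
  nlinarith

theorem IsRounding.norm_sub_le {ρ σ e : ℝ} {c : Pt d} {L : Set ℕ} {j₀ : Fin k}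
    {X Y : Fin k → Pt d} (h : IsRounding ρ σ e c L j₀ X Y) (hL : ∀ s ∈ L, 2 ≤ s) :
    ‖X j₀ - Y j₀‖ ≤ e * (σ / ρ) := by
  have h0 := shell_eq_zero h.near
  have := h.rounded j₀ (fun hmem => by have := hL _ hmem; omega)
  simpa [h0] using this

/-- A centre much farther out than `a` does not serve `a`, even after rounding. -/
theorem IsRounding.norm_sub_le_of_far {ρ σ e : ℝ} {c : Pt d} {L : Set ℕ} {j₀ : Fin k}
    {X Y : Fin k → Pt d} (h : IsRounding ρ σ e c L j₀ X Y) (hL : ∀ s ∈ L, 2 ≤ s)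
    (hσ : 0 < σ) (he : 0 < e) (he1 : e ≤ 1 / 2) (hρ : 6 ≤ ρ) {a : Pt d} {j : Fin k}
    (hfar : shell ρ σ c a + 2 ≤ shell ρ σ c (X j)) :
    ‖a - X j₀‖ ≤ ‖a - X j‖ ∧ ‖a - Y j₀‖ ≤ ‖a - X j‖ ∧
      (shell ρ σ c (X j) ∉ L → ‖a - X j₀‖ ≤ ‖a - Y j‖) := by
  have hρ1 : 1 < ρ := by linarith
  set s := shell ρ σ c (X j) with hs
  -- On the scale `q`: `a` and `X j₀` are within `q` of `c`, `X j` is at least `6 q` away from it,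
  -- and rounding moves a centre by at most `q`.
  obtain ⟨q, hq⟩ : ∃ q, q = ρ ^ (s - 1) * σ := ⟨_, rfl⟩
  have hq0 : 0 < q := by rw [hq]; positivity
  have hsq : ρ ^ s * σ = ρ * q := by
    rw [hq, ← mul_assoc, ← pow_succ']; congr 2; omega
  have ha : ‖a - c‖ ≤ q := by
    refine (norm_sub_lt_of_shell hρ1 hσ c a).le.trans ?_
    rw [hq]
    gcongr
    · exact hρ1.le
    · omega
  have hρσ : ρ * σ ≤ q := by
    rw [hq]
    gcongr
    exact le_self_pow₀ hρ1.le (by omega)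
  have hx : ρ * q ≤ ‖X j - c‖ := by
    rw [← hsq]
    exact le_norm_sub_of_shell c (X j) (by omega)
  have hx0 := h.near
  have hy0 := h.norm_sub_le hL
  have hσρ : e * (σ / ρ) ≤ q := (mul_div_le_mul hσ he1 hρ).trans hρσ
  have t1 : ‖a - X j₀‖ ≤ ‖a - c‖ + ‖X j₀ - c‖ := by
    rw [norm_sub_rev (X j₀)]; exact norm_sub_le_norm_sub_add_norm_sub _ _ _
  have t2 : ‖a - Y j₀‖ ≤ ‖a - X j₀‖ + ‖X j₀ - Y j₀‖ := norm_sub_le_norm_sub_add_norm_sub _ _ _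
  have t3 : ‖X j - c‖ ≤ ‖a - X j‖ + ‖a - c‖ := by
    rw [norm_sub_rev a (X j)]; exact norm_sub_le_norm_sub_add_norm_sub _ _ _
  have t4 : 6 * q ≤ ρ * q := by gcongr
  refine ⟨by linarith, by linarith, fun hj => ?_⟩
  have hr := h.rounded j hj
  rw [← hs, hsq, mul_div_cancel_left₀ _ (by linarith)] at hr
  have t5 : ‖a - X j‖ ≤ ‖a - Y j‖ + ‖X j - Y j‖ := by
    rw [norm_sub_rev (X j)]; exact norm_sub_le_norm_sub_add_norm_sub _ _ _
  nlinarith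

theorem pow_shell_mul_le {ρ σ : ℝ} (c a : Pt d) :
    ρ ^ shell ρ σ c a * σ ≤ max σ ‖a - c‖ := by
  rcases Nat.eq_zero_or_pos (shell ρ σ c a) with h | h
  · rw [h, pow_zero, one_mul]; exact le_max_left _ _
  · exact (le_norm_sub_of_shell c a h).trans (le_max_right _ _)

/-- For a point outside the windows of all moved centres, every centre of `X` can be exchanged for
one of `Y`, and conversely, at additional distance `e * max σ ‖a - c‖`. A centre far outside is
replaced by the one with index `j₀`; a moved centre far inside is as close to `Y j₀` as needed; the
remaining ones are merely rounded. -/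
theorem IsRounding.abs_centerCost_sub_le {ρ σ e : ℝ} {c : Pt d} {L : Set ℕ} {j₀ : Fin k}
    {X Y : Fin k → Pt d} (h : IsRounding ρ σ e c L j₀ X Y) (hL : ∀ s ∈ L, 2 ≤ s)
    (hσ : 0 < σ) (he : 0 < e) (he1 : e ≤ 1 / 2) (hρ : ρ = 3 / e) {a : Pt d}
    (hwin : ∀ j, shell ρ σ c (X j) ∈ L →
      ¬ (shell ρ σ c (X j) ≤ shell ρ σ c a + 1 ∧ shell ρ σ c a ≤ shell ρ σ c (X j) + 1)) :
    |centerCost X a - centerCost Y a| ≤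
      e * centerCost Y a + 2 * e * (‖a - c‖ ^ 2 + σ ^ 2) := by
  have hk : 1 ≤ k := Nat.one_le_iff_ne_zero.2 (by rintro rfl; exact j₀.elim0)
  have hρe : ρ * e = 3 := by rw [hρ]; field_simp
  have hρ6 : 6 ≤ ρ := by rw [hρ, le_div_iff₀ he]; linarith
  have hρ0 : 0 < ρ := by linarith
  obtain ⟨T, hT⟩ : ∃ T, T = max σ ‖a - c‖ := ⟨_, rfl⟩
  have hσT : σ ≤ T := hT ▸ le_max_left _ _
  have hpT : ρ ^ shell ρ σ c a * σ ≤ T := hT ▸ pow_shell_mul_le c a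
  have hround : ∀ j, shell ρ σ c (X j) ∉ L → shell ρ σ c (X j) ≤ shell ρ σ c a + 1 →
      ‖X j - Y j‖ ≤ e * T := by
    intro j hj hs
    refine (h.rounded j hj).trans ?_
    gcongr
    refine le_trans ?_ hpT
    rw [div_le_iff₀ hρ0]
    calc ρ ^ shell ρ σ c (X j) * σ ≤ ρ ^ (shell ρ σ c a + 1) * σ := by
          gcongr
          linarith
      _ = _ := by ring
  have hround0 : ‖X j₀ - Y j₀‖ ≤ e * T := by
    refine hround j₀ (fun hmem => ?_) ?_
    · have := hL _ hmem
      rw [shell_eq_zero h.near] at this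
      omega
    · rw [shell_eq_zero h.near]; omega
  have key := KMeansFilter.abs_centerCost_sub_le hk (X := X) (Y := Y) (a := a) (b := a)
    (D := e * T) he ?_ ?_
  · refine key.trans ?_
    have hT2 : T ^ 2 ≤ ‖a - c‖ ^ 2 + σ ^ 2 := by
      rw [hT]
      rcases max_choice σ ‖a - c‖ with h | h <;> rw [h] <;> nlinarith [sq_nonneg σ, sq_nonneg ‖a - c‖]
    have : (1 + 1 / e) * (e * T) ^ 2 = (e ^ 2 + e) * T ^ 2 := by field_simp
    rw [this]
    have h2 : (e ^ 2 + e) ≤ 2 * e := by nlinarith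
    have := mul_le_mul h2 hT2 (sq_nonneg T) (by positivity)
    linarith
  · intro j
    by_cases hj : shell ρ σ c (X j) ∈ L
    · refine ⟨j₀, ?_⟩
      rcases le_or_gt (shell ρ σ c (X j)) (shell ρ σ c a + 1) with hs | hs
      · have ht : shell ρ σ c (X j) + 2 ≤ shell ρ σ c a := by
          have := hwin j hj
          omega
        have h1 := norm_sub_lt_of_shell (show 1 < ρ by linarith) hσ c (X j)
        -- This fixes `ρ = 3 / e`: three lengths of at most `ρ ^ (s + 1) * σ` (from `X j` to `c`, to
        -- `X j₀`, to `Y j₀`) must together stay below `e * T`, and `a` lies at least two shells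
        -- farther out.
        have h2 : ρ ^ (shell ρ σ c (X j) + 1) * σ * 3 ≤ e * T := by
          calc ρ ^ (shell ρ σ c (X j) + 1) * σ * 3
              = e * (ρ ^ (shell ρ σ c (X j) + 2) * σ) := by rw [← hρe]; ring
            _ ≤ e * (ρ ^ shell ρ σ c a * σ) := by
                gcongr
                linarith
            _ ≤ _ := by gcongr
        have h3 := h.near
        have h4 := h.norm_sub_le hL
        have h5 : ρ * σ ≤ ρ ^ (shell ρ σ c (X j) + 1) * σ := by
          gcongr
          exact le_self_pow₀ (by linarith) (by omega)
        have h6 := mul_div_le_mul hσ he1 hρ6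
        have t1 : ‖a - Y j₀‖ ≤ ‖a - X j‖ + ‖X j - Y j₀‖ := norm_sub_le_norm_sub_add_norm_sub _ _ _
        have t2 : ‖X j - Y j₀‖ ≤ ‖X j - c‖ + ‖c - Y j₀‖ := norm_sub_le_norm_sub_add_norm_sub _ _ _
        have t3 : ‖c - Y j₀‖ ≤ ‖X j₀ - c‖ + ‖X j₀ - Y j₀‖ := by
          rw [norm_sub_rev (X j₀) c]; exact norm_sub_le_norm_sub_add_norm_sub _ _ _
        linarith
      · have := (h.norm_sub_le_of_far hL hσ he he1 hρ6 (a := a) (j := j) (by omega)).2.1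
        have : 0 ≤ e * T := (norm_nonneg _).trans hround0
        linarith
    · rcases le_or_gt (shell ρ σ c (X j)) (shell ρ σ c a + 1) with hs | hs
      · refine ⟨j, ?_⟩
        have t1 : ‖a - Y j‖ ≤ ‖a - X j‖ + ‖X j - Y j‖ := norm_sub_le_norm_sub_add_norm_sub _ _ _
        linarith [hround j hj hs]
      · refine ⟨j₀, ?_⟩
        have := (h.norm_sub_le_of_far hL hσ he he1 hρ6 (a := a) (j := j) (by omega)).2.1
        have : 0 ≤ e * T := (norm_nonneg _).trans hround0
        linarith
  · intro j
    by_cases hj : shell ρ σ c (X j) ∈ L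
    · refine ⟨j₀, ?_⟩
      rw [h.moved j hj]
      have t1 : ‖a - X j₀‖ ≤ ‖a - Y j₀‖ + ‖X j₀ - Y j₀‖ := by
        rw [norm_sub_rev (X j₀)]; exact norm_sub_le_norm_sub_add_norm_sub _ _ _
      linarith
    · rcases le_or_gt (shell ρ σ c (X j)) (shell ρ σ c a + 1) with hs | hs
      · refine ⟨j, ?_⟩
        have t1 : ‖a - X j‖ ≤ ‖a - Y j‖ + ‖X j - Y j‖ := by
          rw [norm_sub_rev (X j)]; exact norm_sub_le_norm_sub_add_norm_sub _ _ _
        linarith [hround j hj hs]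
      · refine ⟨j₀, ?_⟩
        have := (h.norm_sub_le_of_far hL hσ he he1 hρ6 (a := a) (j := j) (by omega)).2.2 hj
        have : 0 ≤ e * T := (norm_nonneg _).trans hround0
        linarith

/-- The crude bound for points inside the window of a moved centre: `X j₀` and `Y j₀` already serve
such a point at distance at most `3 ‖a - c‖`. It is affordable because light windows carry little
cost. -/
theorem IsRounding.abs_centerCost_sub_le_of_one_le {ρ σ e : ℝ} {c : Pt d} {L : Set ℕ} {j₀ : Fin k}
    {X Y : Fin k → Pt d} (h : IsRounding ρ σ e c L j₀ X Y) (hL : ∀ s ∈ L, 2 ≤ s)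
    (hσ : 0 < σ) (he : 0 < e) (he1 : e ≤ 1 / 2) (hρ : ρ = 3 / e) {a : Pt d}
    (ha : 1 ≤ shell ρ σ c a) :
    |centerCost X a - centerCost Y a| ≤ 10 * ‖a - c‖ ^ 2 := by
  have hρ6 : 6 ≤ ρ := by rw [hρ, le_div_iff₀ he]; linarith
  have hρσ : ρ * σ ≤ ‖a - c‖ := by
    refine le_trans ?_ (le_norm_sub_of_shell c a ha)
    gcongr
    exact le_self_pow₀ (by linarith) (by omega)
  have h1 := h.near
  have h2 := h.norm_sub_le hL
  have h6 := mul_div_le_mul hσ he1 hρ6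
  have t1 : ‖a - X j₀‖ ≤ ‖a - c‖ + ‖X j₀ - c‖ := by
    rw [norm_sub_rev (X j₀)]; exact norm_sub_le_norm_sub_add_norm_sub _ _ _
  have t2 : ‖a - Y j₀‖ ≤ ‖a - X j₀‖ + ‖X j₀ - Y j₀‖ := norm_sub_le_norm_sub_add_norm_sub _ _ _
  have hX : centerCost X a ≤ (3 * ‖a - c‖) ^ 2 := by
    refine (centerCost_le X a j₀).trans ?_
    gcongr
    linarith [norm_nonneg (a - c)]
  have hY : centerCost Y a ≤ (3 * ‖a - c‖) ^ 2 := by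
    refine (centerCost_le Y a j₀).trans ?_
    gcongr
    linarith
  have := centerCost_nonneg X a
  have := centerCost_nonneg Y a
  rw [abs_le]
  constructor <;> nlinarith [sq_nonneg ‖a - c‖]

end Geometry

/-! ### Deviation of the cost for fixed weights -/

section Weights

variable {n d k : ℕ}

theorem meanCost_eq (A : Fin n → Pt d) : meanCost A = ∑ i, ‖A i - prefixMean A n‖ ^ 2 := rfl

theorem one_add_inv_mul_le {e S M N : ℝ} (he : 0 < e) (he1 : e ≤ 1 / 2) (hM : 0 ≤ M)
    (hS : S ≤ 2 * M) (hN : 9 * M ≤ e ^ 2 * N) : (1 + 1 / e) * (S + M) ≤ e * N := by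
  have h1 : 1 + 1 / e = (e + 1) / e := by field_simp
  rw [h1, div_mul_eq_mul_div, div_le_iff₀ he]
  nlinarith

/-- The deviation for centres that are all far from the mean. -/
theorem abs_sum_centerCost_le_of_far (hk : 1 ≤ k) (A : Fin n → Pt d) {w : Fin n → ℝ}
    (hw : ∀ i, 0 ≤ w i) {e : ℝ} (he : 0 < e) (he1 : e ≤ 1 / 2) (X : Fin k → Pt d)
    (hX : ∀ j, 9 * meanCost A ≤ e ^ 2 * (n * ‖prefixMean A n - X j‖ ^ 2))
    (hcount : |∑ i, (w i - 1)| ≤ e * n)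
    (hmean : ∑ i, ‖A i - prefixMean A n‖ ^ 2 * w i ≤ 2 * meanCost A) :
    |∑ i, centerCost X (A i) * (w i - 1)| ≤ 10 * e * (cost X A + meanCost A) := by
  set c := prefixMean A n with hc
  obtain ⟨j, hj⟩ := exists_centerCost_eq hk X c
  obtain ⟨D, hD⟩ : ∃ D, D = centerCost X c := ⟨_, rfl⟩
  rw [← hD] at hj
  have hD0 : 0 ≤ D := hD ▸ centerCost_nonneg X c
  have hXD : 9 * meanCost A ≤ e ^ 2 * (n * D) := by rw [hj]; exact hX j
  have hpt : ∀ i, |centerCost X (A i) - D| ≤ e * D + (1 + 1 / e) * ‖A i - c‖ ^ 2 := by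
    intro i
    rw [hD]
    refine abs_centerCost_sub_le hk he (fun j => ⟨j, ?_⟩) (fun j => ⟨j, ?_⟩)
    · have := norm_sub_le_norm_sub_add_norm_sub c (A i) (X j)
      rw [norm_sub_rev c (A i)] at this
      linarith
    · have := norm_sub_le_norm_sub_add_norm_sub (A i) c (X j)
      linarith
  -- The constant part `D` is governed by the total weight, the fluctuation around it by the plain
  -- and the weighted cost with respect to the mean.
  have hsplit : ∑ i, centerCost X (A i) * (w i - 1) =
      D * ∑ i, (w i - 1) + ∑ i, (centerCost X (A i) - D) * (w i - 1) := by
    rw [Finset.mul_sum, ← Finset.sum_add_distrib]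
    exact Finset.sum_congr rfl fun i _ => by ring
  have hsecond : |∑ i, (centerCost X (A i) - D) * (w i - 1)| ≤
      ∑ i, (e * D + (1 + 1 / e) * ‖A i - c‖ ^ 2) * (w i + 1) := by
    refine (Finset.abs_sum_le_sum_abs _ _).trans (Finset.sum_le_sum fun i _ => ?_)
    rw [abs_mul]
    gcongr
    · exact hpt i
    · rw [abs_le]; constructor <;> linarith [hw i]
  have hexpand : ∑ i, (e * D + (1 + 1 / e) * ‖A i - c‖ ^ 2) * (w i + 1) =
      e * D * (∑ i, (w i - 1) + 2 * n) +
        (1 + 1 / e) * (∑ i, ‖A i - c‖ ^ 2 * w i + meanCost A) := by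
    have h2 : (2 * n : ℝ) = ∑ _i : Fin n, (2 : ℝ) := by simp [mul_comm]
    rw [h2, ← Finset.sum_add_distrib, meanCost_eq, ← Finset.sum_add_distrib, Finset.mul_sum,
      Finset.mul_sum, ← Finset.sum_add_distrib]
    exact Finset.sum_congr rfl fun i _ => by ring
  have hM := one_add_inv_mul_le he he1 (meanCost_nonneg A) hmean hXD
  have hfirst : |D * ∑ i, (w i - 1)| ≤ e * (n * D) := by
    rw [abs_mul, abs_of_nonneg hD0]
    calc _ ≤ D * (e * n) := by gcongr
      _ = _ := by ring
  have hmid : e * D * (∑ i, (w i - 1) + 2 * n) ≤ 3 * (e * (n * D)) := by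
    have h3 : ∑ i, (w i - 1) + 2 * n ≤ 3 * (n : ℝ) := by
      have := (abs_le.1 hcount).2
      nlinarith [(Nat.cast_nonneg n : (0 : ℝ) ≤ n)]
    calc _ ≤ e * D * (3 * n) := by gcongr
      _ = _ := by ring
  have hnD : n * D ≤ 2 * (cost X A + meanCost A) := by
    have h4 : (n : ℝ) * D = ∑ _i : Fin n, D := by simp
    rw [h4, cost, meanCost_eq, ← Finset.sum_add_distrib, Finset.mul_sum]
    refine Finset.sum_le_sum fun i _ => ?_
    have := centerCost_le_two_mul hk X c (A i)
    rw [norm_sub_rev, ← hD] at this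
    linarith
  rw [hsplit]
  calc _ ≤ _ := abs_add_le _ _
    _ ≤ 5 * e * (n * D) := by rw [hexpand] at hsecond; linarith
    _ ≤ 5 * e * (2 * (cost X A + meanCost A)) := by gcongr
    _ = _ := by ring

/-- The shells adjacent to the shell `s`, and `s` itself. -/
abbrev InWindow (s t : ℕ) : Prop := s ≤ t + 1 ∧ t ≤ s + 1

/-- The sum of `v` over the points whose shell is in the window of `s`. -/
noncomputable def windowSum (ρ σ : ℝ) (c : Pt d) (A : Fin n → Pt d) (v : Fin n → ℝ) (s : ℕ) : ℝ :=
  ∑ i, if InWindow s (shell ρ σ c (A i)) then v i else 0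

theorem IsRounding.sum_abs_centerCost_sub_le {ρ σ e : ℝ} {c : Pt d} {L : Set ℕ} {j₀ : Fin k}
    {X Y : Fin k → Pt d} (h : IsRounding ρ σ e c L j₀ X Y) (hL : ∀ s ∈ L, 2 ≤ s)
    (hσ : 0 < σ) (he : 0 < e) (he1 : e ≤ 1 / 2) (hρ : ρ = 3 / e) (A : Fin n → Pt d)
    {S : Finset ℕ} (hS : ∀ j, shell ρ σ c (X j) ∈ L → shell ρ σ c (X j) ∈ S)
    {v : Fin n → ℝ} (hv : ∀ i, 0 ≤ v i) :
    ∑ i, |centerCost X (A i) - centerCost Y (A i)| * v i ≤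
      e * ∑ i, centerCost Y (A i) * v i +
        2 * e * (∑ i, ‖A i - c‖ ^ 2 * v i + σ ^ 2 * ∑ i, v i) +
        10 * ∑ s ∈ S, windowSum ρ σ c A (fun i => ‖A i - c‖ ^ 2 * v i) s := by
  have hsw : ∑ s ∈ S, windowSum ρ σ c A (fun i => ‖A i - c‖ ^ 2 * v i) s =
      ∑ i, ∑ s ∈ S, if InWindow s (shell ρ σ c (A i)) then ‖A i - c‖ ^ 2 * v i else 0 :=
    Finset.sum_comm
  rw [hsw]
  simp only [Finset.mul_sum, ← Finset.sum_add_distrib]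
  refine Finset.sum_le_sum fun i _ => ?_
  rw [← Finset.mul_sum]
  have hvi := hv i
  have hY := centerCost_nonneg Y (A i)
  have hterm : ∀ s, 0 ≤ if InWindow s (shell ρ σ c (A i)) then ‖A i - c‖ ^ 2 * v i else 0 := by
    intro s; split_ifs <;> positivity
  by_cases hw : ∃ j, shell ρ σ c (X j) ∈ L ∧ InWindow (shell ρ σ c (X j)) (shell ρ σ c (A i))
  · obtain ⟨j, hj, hjw⟩ := hw
    have h1 : 1 ≤ shell ρ σ c (A i) := by
      have := hL _ hj
      have := hjw.1
      omega
    have h2 := h.abs_centerCost_sub_le_of_one_le hL hσ he he1 hρ h1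
    have h3 := Finset.single_le_sum (fun s _ => hterm s) (hS j hj)
    rw [if_pos hjw] at h3
    have h4 : |centerCost X (A i) - centerCost Y (A i)| * v i ≤ 10 * ‖A i - c‖ ^ 2 * v i := by
      gcongr
    have h5 : 0 ≤ e * (centerCost Y (A i) * v i) := by positivity
    have h6 : 0 ≤ 2 * e * (‖A i - c‖ ^ 2 * v i + σ ^ 2 * v i) := by positivity
    linarith
  · push Not at hw
    have h2 := h.abs_centerCost_sub_le hL hσ he he1 hρ (a := A i)
      (fun j hj hjw => by exact hw j hj hjw)
    have h4 := mul_le_mul_of_nonneg_right h2 hvi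
    have h3 := Finset.sum_nonneg (s := S) fun s _ => hterm s
    linarith

/-- The deviation for centres `X`, one of them near the mean, from that for the rounding `Y`. -/
theorem IsRounding.abs_sum_centerCost_le {ρ σ e : ℝ} {A : Fin n → Pt d} {L : Set ℕ} {j₀ : Fin k}
    {X Y : Fin k → Pt d} (h : IsRounding ρ σ e (prefixMean A n) L j₀ X Y) (hL : ∀ s ∈ L, 2 ≤ s)
    (hσ : 0 < σ) (he : 0 < e) (he1 : e ≤ 1 / 2) (hρ : ρ = 3 / e) (hσM : σ ^ 2 * n = meanCost A)
    {S : Finset ℕ} (hS : ∀ j, shell ρ σ (prefixMean A n) (X j) ∈ L →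
      shell ρ σ (prefixMean A n) (X j) ∈ S)
    {w : Fin n → ℝ} (hw : ∀ i, 0 ≤ w i)
    (hY : |∑ i, centerCost Y (A i) * (w i - 1)| ≤ e * (cost Y A + meanCost A))
    (hcount : |∑ i, (w i - 1)| ≤ e * n)
    (hmean : ∑ i, ‖A i - prefixMean A n‖ ^ 2 * w i ≤ 2 * meanCost A)
    (hlight : ∑ s ∈ S, windowSum ρ σ (prefixMean A n) A
      (fun i => ‖A i - prefixMean A n‖ ^ 2) s ≤ e * meanCost A)
    (hlight' : ∑ s ∈ S, windowSum ρ σ (prefixMean A n) A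
      (fun i => ‖A i - prefixMean A n‖ ^ 2 * w i) s ≤ 3 * e * meanCost A) :
    |∑ i, centerCost X (A i) * (w i - 1)| ≤ 110 * e * (cost X A + meanCost A) := by
  set c := prefixMean A n with hc
  have hM0 := meanCost_nonneg A
  have hfX := cost_nonneg X A
  have hfY := cost_nonneg Y A
  have h1 := h.sum_abs_centerCost_sub_le hL hσ he he1 hρ A hS (v := fun _ => 1)
    (fun _ => zero_le_one)
  have h2 := h.sum_abs_centerCost_sub_le hL hσ he he1 hρ A hS hw
  simp only [mul_one, Finset.sum_const, Finset.card_univ, Fintype.card_fin, nsmul_eq_mul] at h1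
  rw [← meanCost_eq, hσM] at h1
  have hcostY : ∑ i, centerCost Y (A i) = cost Y A := rfl
  rw [hcostY] at h1
  have hsw : ∑ i, w i ≤ 2 * n := by
    rw [Finset.sum_sub_distrib] at hcount
    have := (abs_le.1 hcount).2
    simp only [Finset.sum_const, Finset.card_univ, Fintype.card_fin, nsmul_eq_mul, mul_one] at this
    nlinarith [(Nat.cast_nonneg n : (0 : ℝ) ≤ n)]
  have hsw' : σ ^ 2 * ∑ i, w i ≤ 2 * meanCost A := by
    rw [← hσM]
    nlinarith [sq_nonneg σ]
  have hYw : ∑ i, centerCost Y (A i) * w i ≤ 2 * cost Y A + meanCost A := by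
    have h3 := (abs_le.1 hY).2
    simp only [mul_sub, mul_one, Finset.sum_sub_distrib] at h3
    rw [hcostY] at h3
    nlinarith
  have hU1 : ∑ i, |centerCost X (A i) - centerCost Y (A i)| ≤ e * cost Y A + 14 * e * meanCost A := by
    linarith
  have hU2 : ∑ i, |centerCost X (A i) - centerCost Y (A i)| * w i ≤
      e * (2 * cost Y A + meanCost A) + 38 * e * meanCost A := by
    have h3 := mul_le_mul_of_nonneg_left hYw he.le
    have h4 := mul_le_mul_of_nonneg_left (add_le_add hmean hsw') (by positivity : 0 ≤ 2 * e)
    linarith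
  -- Since `e ≤ 1 / 2`, the term `e * cost Y A` of `hU1` is absorbed on the left.
  have hYX : cost Y A ≤ 2 * cost X A + 14 * meanCost A := by
    have h3 : cost Y A - cost X A ≤ ∑ i, |centerCost X (A i) - centerCost Y (A i)| := by
      rw [cost, cost, ← Finset.sum_sub_distrib]
      refine Finset.sum_le_sum fun i _ => ?_
      rw [abs_sub_comm]
      exact le_abs_self _
    nlinarith
  have hsplit : ∑ i, centerCost X (A i) * (w i - 1) = ∑ i, centerCost Y (A i) * (w i - 1) +
      ∑ i, (centerCost X (A i) - centerCost Y (A i)) * (w i - 1) := by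
    rw [← Finset.sum_add_distrib]
    exact Finset.sum_congr rfl fun i _ => by ring
  have hdiff : |∑ i, (centerCost X (A i) - centerCost Y (A i)) * (w i - 1)| ≤
      ∑ i, |centerCost X (A i) - centerCost Y (A i)| +
        ∑ i, |centerCost X (A i) - centerCost Y (A i)| * w i := by
    rw [← Finset.sum_add_distrib]
    refine (Finset.abs_sum_le_sum_abs _ _).trans (Finset.sum_le_sum fun i _ => ?_)
    have : |w i - 1| ≤ 1 + w i := by rw [abs_le]; constructor <;> linarith [hw i]
    rw [abs_mul]
    nlinarith [abs_nonneg (centerCost X (A i) - centerCost Y (A i))]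
  -- The three contributions to the coefficient of `meanCost A` are `15 e` (from `hY`), `28 e` (from
  -- `hU1`) and `67 e` (from `hU2`), after `hYX`; hence `110`.
  rw [hsplit]
  refine (abs_add_le _ _).trans ?_
  nlinarith

end Weights

/-! ### Deviation of the cost, uniformly in the centres -/

section Uniform

variable {n d k : ℕ}

/-- The probabilities `p` dominate the sensitivities of the points for `k` centres, times `r`. -/
structure IsSensitivitySampling (k : ℕ) (r : ℝ) (A : Fin n → Pt d) (p : Fin n → ℝ) : Prop where
  pos : ∀ i, 0 < p i
  le_one : ∀ i, p i ≤ 1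
  count : ∀ i, p i = 1 ∨ r ≤ p i * n
  sens : ∀ i, p i = 1 ∨ ∀ X : Fin k → Pt d,
    r * centerCost X (A i) ≤ p i * (cost X A + meanCost A)

/-- Take all `k` centres equal to the mean; then both cost terms equal `meanCost A`. -/
theorem IsSensitivitySampling.mean (hk : 1 ≤ k) {r : ℝ} {A : Fin n → Pt d} {p : Fin n → ℝ}
    (h : IsSensitivitySampling k r A p) (i : Fin n) :
    p i = 1 ∨ r * ‖A i - prefixMean A n‖ ^ 2 ≤ p i * (2 * meanCost A) := by
  rcases h.sens i with h1 | h1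
  · exact Or.inl h1
  · right
    have : Nonempty (Fin k) := ⟨⟨0, hk⟩⟩
    have hc : ∀ a, centerCost (fun _ : Fin k => prefixMean A n) a = ‖a - prefixMean A n‖ ^ 2 := by
      intro a
      simp [centerCost, sqDist]
    have h2 := h1 fun _ => prefixMean A n
    simp only [cost, hc] at h2
    rw [← meanCost_eq, ← two_mul] at h2
    exact h2

theorem IsSensitivitySampling.measureReal_cost_le {r e : ℝ} {A : Fin n → Pt d} {p : Fin n → ℝ}
    (h : IsSensitivitySampling k r A p) (hr : 0 < r) (he : 0 ≤ e) (he1 : e ≤ 1)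
    (hM : 0 < meanCost A) (X : Fin k → Pt d) :
    (volume : Measure (Fin n → unitInterval)).real
      {u | e * (cost X A + meanCost A) < |deviation p (fun i => centerCost X (A i)) u|} ≤
      2 * Real.exp (-(r * e ^ 2 / 4)) := by
  have hX := cost_nonneg X A
  refine measureReal_deviation_gt_le hr (by linarith) he he1 h.pos h.le_one
    (fun i => centerCost_nonneg _ _) (fun i => ?_) ?_
  · exact (h.sens i).imp_right fun h1 => h1 X
  · exact le_add_of_nonneg_right hM.le

theorem IsSensitivitySampling.measureReal_count_le {r e : ℝ} {A : Fin n → Pt d} {p : Fin n → ℝ}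
    (h : IsSensitivitySampling k r A p) (hr : 0 < r) (he : 0 ≤ e) (he1 : e ≤ 1) :
    (volume : Measure (Fin n → unitInterval)).real
      {u | e * n < |deviation p (fun _ => 1) u|} ≤ 2 * Real.exp (-(r * e ^ 2 / 4)) := by
  rcases Nat.eq_zero_or_pos n with rfl | hn
  · have : {u : Fin 0 → unitInterval | e * (0 : ℕ) < |deviation p (fun _ => 1) u|} = ∅ := by
      ext u; simp [deviation]
    rw [this, measureReal_empty]
    positivity
  · refine measureReal_deviation_gt_le hr (by exact_mod_cast hn) he he1 h.pos h.le_one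
      (fun i => zero_le_one) (fun i => ?_) (by simp)
    simpa using h.count i

theorem IsSensitivitySampling.measureReal_mean_le (hk : 1 ≤ k) {r : ℝ} {A : Fin n → Pt d}
    {p : Fin n → ℝ} (h : IsSensitivitySampling k r A p) (hr : 0 < r) (hM : 0 < meanCost A) :
    (volume : Measure (Fin n → unitInterval)).real
      {u | meanCost A < |deviation p (fun i => ‖A i - prefixMean A n‖ ^ 2) u|} ≤
      2 * Real.exp (-(r * (1 / 2) ^ 2 / 4)) := by
  have key := measureReal_deviation_gt_le (e := 1 / 2) (G := 2 * meanCost A) hr (by linarith)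
    (by norm_num) (by norm_num) h.pos h.le_one (fun i => sq_nonneg ‖A i - prefixMean A n‖)
    (h.mean hk) (by rw [← meanCost_eq]; linarith)
  rwa [show (1 / 2 : ℝ) * (2 * meanCost A) = meanCost A by ring] at key

/-! ### Windows of shells: overlap, second moments, heavy and light shells. -/

theorem sum_windowSum_le (ρ σ : ℝ) (c : Pt d) (A : Fin n → Pt d) {v : Fin n → ℝ}
    (hv : ∀ i, 0 ≤ v i) (S : Finset ℕ) :
    ∑ s ∈ S, windowSum ρ σ c A v s ≤ 3 * ∑ i, v i := by
  unfold windowSum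
  rw [Finset.sum_comm, Finset.mul_sum]
  refine Finset.sum_le_sum fun i _ => ?_
  rw [← Finset.sum_filter, Finset.sum_const, nsmul_eq_mul]
  refine mul_le_mul_of_nonneg_right ?_ (hv i)
  -- A point in shell `t` lies in the windows of `t - 1`, `t` and `t + 1` only.
  have h1 : S.filter (fun s => InWindow s (shell ρ σ c (A i))) ⊆
      Finset.Icc (shell ρ σ c (A i) - 1) (shell ρ σ c (A i) + 1) := by
    intro s hs
    have := (Finset.mem_filter.1 hs).2
    rw [Finset.mem_Icc]
    omega
  have h2 := Finset.card_le_card h1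
  rw [Nat.card_Icc] at h2
  have h3 : (S.filter (fun s => InWindow s (shell ρ σ c (A i)))).card ≤ 3 := by omega
  exact_mod_cast h3

/-- A bound on the shells in the windows of the points of `A`. -/
noncomputable def shellBound (ρ σ : ℝ) (c : Pt d) (A : Fin n → Pt d) : ℕ :=
  (Finset.univ.sup fun i => shell ρ σ c (A i)) + 2

theorem not_inWindow_of_shellBound_le {ρ σ : ℝ} {c : Pt d} {A : Fin n → Pt d} {s : ℕ}
    (hs : shellBound ρ σ c A ≤ s) (i : Fin n) : ¬ InWindow s (shell ρ σ c (A i)) := by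
  have h1 : shell ρ σ c (A i) ≤ Finset.univ.sup fun i => shell ρ σ c (A i) :=
    Finset.le_sup (f := fun i => shell ρ σ c (A i)) (Finset.mem_univ i)
  unfold shellBound at hs
  intro h2
  have := h2.1
  omega

theorem windowSum_eq_zero {ρ σ : ℝ} {c : Pt d} {A : Fin n → Pt d} {s : ℕ} (v : Fin n → ℝ)
    (hs : shellBound ρ σ c A ≤ s) : windowSum ρ σ c A v s = 0 :=
  Finset.sum_eq_zero fun i _ => if_neg (not_inWindow_of_shellBound_le hs i)

/-- The deviation of the mean cost of the window of `s`. -/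
noncomputable def windowDeviation (ρ σ : ℝ) (A : Fin n → Pt d) (p : Fin n → ℝ) (s : ℕ)
    (u : Fin n → unitInterval) : ℝ :=
  deviation p (fun i => if InWindow s (shell ρ σ (prefixMean A n) (A i)) then
    ‖A i - prefixMean A n‖ ^ 2 else 0) u

theorem windowSum_mul_sampleWeight (ρ σ : ℝ) (A : Fin n → Pt d) (p : Fin n → ℝ) (s : ℕ)
    (u : Fin n → unitInterval) :
    windowSum ρ σ (prefixMean A n) A
        (fun i => ‖A i - prefixMean A n‖ ^ 2 * sampleWeight (p i) (u i)) s =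
      windowSum ρ σ (prefixMean A n) A (fun i => ‖A i - prefixMean A n‖ ^ 2) s +
        windowDeviation ρ σ A p s u := by
  unfold windowSum windowDeviation deviation
  rw [← Finset.sum_add_distrib]
  refine Finset.sum_congr rfl fun i _ => ?_
  by_cases h : InWindow s (shell ρ σ (prefixMean A n) (A i))
  · simp only [if_pos h]; ring
  · simp only [if_neg h]; ring

theorem windowDeviation_eq_zero {ρ σ : ℝ} {A : Fin n → Pt d} {s : ℕ} (p : Fin n → ℝ)
    (hs : shellBound ρ σ (prefixMean A n) A ≤ s) (u : Fin n → unitInterval) :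
    windowDeviation ρ σ A p s u = 0 := by
  unfold windowDeviation deviation
  exact Finset.sum_eq_zero fun i _ => by
    simp only [if_neg (not_inWindow_of_shellBound_le hs i), zero_mul]

/-- Markov's inequality for the sum of squares. Each window contributes at most `8 * meanCost A / r`
times its own cost, and these costs sum to at most `3 * meanCost A`, so the number of windows does
not enter. -/
theorem IsSensitivitySampling.measureReal_window_le (hk : 1 ≤ k) {r : ℝ} {A : Fin n → Pt d}
    {p : Fin n → ℝ} (h : IsSensitivitySampling k r A p) (hr : 1 ≤ r) (hM : 0 < meanCost A)
    (ρ σ : ℝ) {δ : ℝ} (hδ : 0 < δ) (S : Finset ℕ) :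
    (volume : Measure (Fin n → unitInterval)).real
      {u | δ ≤ ∑ s ∈ S, windowDeviation ρ σ A p s u ^ 2} ≤ 24 * meanCost A ^ 2 / (r * δ) := by
  have hr0 : 0 < r := by linarith
  set m : Fin n → ℝ := fun i => ‖A i - prefixMean A n‖ ^ 2 with hm
  have hm0 : ∀ i, 0 ≤ m i := fun i => sq_nonneg _
  have hsqInt : ∀ s, Integrable (fun u => windowDeviation ρ σ A p s u ^ 2) := fun s =>
    integrable_comp_deviation p _ (g := fun x => x ^ 2) (by fun_prop)
  have hsq : ∀ s, ∫ u, windowDeviation ρ σ A p s u ^ 2 ≤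
      4 * (2 * meanCost A) * windowSum ρ σ (prefixMean A n) A m s / r := by
    intro s
    refine integral_sq_deviation_le hr (by linarith) h.pos h.le_one (fun i => ?_) (fun i => ?_) ?_
    · split_ifs
      · exact hm0 i
      · exact le_rfl
    · split_ifs
      · exact h.mean hk i
      · right
        have := h.pos i
        rw [mul_zero]
        positivity
    · calc _ ≤ ∑ i, m i := by
            refine Finset.sum_le_sum fun i _ => ?_
            split_ifs
            · exact le_rfl
            · exact hm0 i
        _ ≤ _ := by rw [hm, ← meanCost_eq]; linarith
  have hmarkov := mul_meas_ge_le_integral_of_nonneg (μ := (volume : Measure (Fin n → unitInterval)))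
    (f := fun u => ∑ s ∈ S, windowDeviation ρ σ A p s u ^ 2)
    (Filter.Eventually.of_forall fun u => Finset.sum_nonneg fun s _ => sq_nonneg _)
    (integrable_finsetSum _ fun s _ => hsqInt s) δ
  rw [integral_finsetSum _ fun s _ => hsqInt s] at hmarkov
  have htot : ∑ s ∈ S, ∫ u, windowDeviation ρ σ A p s u ^ 2 ≤ 24 * meanCost A ^ 2 / r := by
    calc _ ≤ ∑ s ∈ S, 4 * (2 * meanCost A) * windowSum ρ σ (prefixMean A n) A m s / r :=
          Finset.sum_le_sum fun s _ => hsq s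
      _ = 8 * meanCost A / r * ∑ s ∈ S, windowSum ρ σ (prefixMean A n) A m s := by
          rw [Finset.mul_sum]
          exact Finset.sum_congr rfl fun s _ => by ring
      _ ≤ 8 * meanCost A / r * (3 * ∑ i, m i) := by
          gcongr
          exact sum_windowSum_le _ _ _ _ hm0 S
      _ = _ := by rw [hm, ← meanCost_eq]; ring
  rw [← div_div, le_div_iff₀ hδ, mul_comm]
  exact hmarkov.trans htot

/-- The shells that are treated as heavy: the two innermost ones and those whose window
has cost more than `τ` with respect to the mean. -/
noncomputable def heavyShells (ρ σ τ : ℝ) (A : Fin n → Pt d) : Finset ℕ :=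
  {0, 1} ∪ (Finset.range (shellBound ρ σ (prefixMean A n) A)).filter fun s =>
    τ < windowSum ρ σ (prefixMean A n) A (fun i => ‖A i - prefixMean A n‖ ^ 2) s

theorem two_le_of_notMem_heavyShells {ρ σ τ : ℝ} {A : Fin n → Pt d} {s : ℕ}
    (hs : s ∉ heavyShells ρ σ τ A) : 2 ≤ s := by
  by_contra! h
  apply hs
  unfold heavyShells
  interval_cases s <;> simp

theorem windowSum_le_of_notMem_heavyShells {ρ σ τ : ℝ} (hτ : 0 ≤ τ) {A : Fin n → Pt d} {s : ℕ}
    (hs : s ∉ heavyShells ρ σ τ A) :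
    windowSum ρ σ (prefixMean A n) A (fun i => ‖A i - prefixMean A n‖ ^ 2) s ≤ τ := by
  rcases le_or_gt (shellBound ρ σ (prefixMean A n) A) s with h | h
  · rw [windowSum_eq_zero _ h]; exact hτ
  · by_contra! h1
    exact hs (Finset.mem_union_right _ (Finset.mem_filter.2 ⟨Finset.mem_range.2 h, h1⟩))

theorem card_heavyShells_le (ρ σ : ℝ) {τ : ℝ} (hτ : 0 < τ) (A : Fin n → Pt d) :
    ((heavyShells ρ σ τ A).card : ℝ) ≤ 2 + 3 * meanCost A / τ := by
  set F := (Finset.range (shellBound ρ σ (prefixMean A n) A)).filter fun s =>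
    τ < windowSum ρ σ (prefixMean A n) A (fun i => ‖A i - prefixMean A n‖ ^ 2) s with hF
  have h1 : (heavyShells ρ σ τ A).card ≤ 2 + F.card :=
    (Finset.card_union_le _ _).trans (by simp [hF])
  have h2 : F.card * τ ≤ 3 * meanCost A := by
    calc F.card * τ = ∑ s ∈ F, τ := by rw [Finset.sum_const, nsmul_eq_mul]
      _ ≤ ∑ s ∈ F, windowSum ρ σ (prefixMean A n) A (fun i => ‖A i - prefixMean A n‖ ^ 2) s :=
          Finset.sum_le_sum fun s hs => (Finset.mem_filter.1 hs).2.le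
      _ ≤ _ := sum_windowSum_le _ _ _ _ (fun i => sq_nonneg _) F
  rw [← le_div_iff₀ hτ] at h2
  have h3 : ((heavyShells ρ σ τ A).card : ℝ) ≤ 2 + F.card := by exact_mod_cast h1
  linarith

/-- A finite set of points that suffices for roundings, for a finite set `H` of heavy shells. -/
theorem exists_rounding_net {ρ σ e : ℝ} (hσ : 0 < σ) (he : 0 < e) (he1 : e ≤ 1 / 2)
    (hρ : ρ = 3 / e) (c : Pt d) (H : Finset ℕ) (h0 : 0 ∈ H) :
    ∃ P : Finset (Pt d), (P.card : ℝ) ≤ H.card * (1 + 18 / e ^ 3) ^ d ∧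
      ∀ (X : Fin k → Pt d) (j₀ : Fin k), ‖X j₀ - c‖ < ρ * σ →
        ∃ Y : Fin k → Pt d, (∀ j, Y j ∈ P) ∧ IsRounding ρ σ e c {s | s ∉ H} j₀ X Y := by
  classical
  have hρ0 : 0 < ρ := by rw [hρ]; positivity
  have hρ1 : 1 < ρ := by rw [hρ, lt_div_iff₀ he]; linarith
  have hnet : ∀ s : ℕ, ∃ N : Finset (Pt d), (N.card : ℝ) ≤ (1 + 18 / e ^ 3) ^ d ∧
      ∀ x, ‖x - c‖ ≤ ρ ^ (s + 1) * σ → ∃ y ∈ N, ‖x - y‖ ≤ e * (ρ ^ s * σ / ρ) := by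
    intro s
    -- The ratio `2 R / δ` equals `2 ρ² / e = 18 / e³` at every scale.
    obtain ⟨N, hN, hN'⟩ := exists_ball_net (R := ρ ^ (s + 1) * σ) (δ := e * (ρ ^ s * σ / ρ))
      (by positivity) (by positivity) c
    refine ⟨N, hN.trans_eq ?_, hN'⟩
    congr 2
    have : 2 * (ρ ^ (s + 1) * σ) / (e * (ρ ^ s * σ / ρ)) = 2 * ρ ^ 2 / e := by
      field_simp
      ring
    rw [this, hρ]
    field_simp
    norm_num
  choose N hN hN' using hnet
  refine ⟨H.biUnion N, ?_, fun X j₀ hj₀ => ?_⟩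
  · calc ((H.biUnion N).card : ℝ) ≤ ∑ s ∈ H, ((N s).card : ℝ) := by
          exact_mod_cast Finset.card_biUnion_le
      _ ≤ ∑ _s ∈ H, (1 + 18 / e ^ 3) ^ d := Finset.sum_le_sum fun s _ => hN s
      _ = _ := by rw [Finset.sum_const, nsmul_eq_mul]
  · choose f hf hf' using fun x : Pt d =>
      hN' (shell ρ σ c x) x (norm_sub_lt_of_shell hρ1 hσ c x).le
    have hs0 := shell_eq_zero hj₀
    -- `X j₀` lies in shell `0`, which belongs to `H`, so its rounding is available as the target of
    -- the moved centres.
    refine ⟨fun j => if shell ρ σ c (X j) ∈ H then f (X j) else f (X j₀), fun j => ?_, hj₀, ?_, ?_⟩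
    · rw [Finset.mem_biUnion]
      by_cases hj : shell ρ σ c (X j) ∈ H
      · exact ⟨_, hj, by simp only [if_pos hj]; exact hf (X j)⟩
      · refine ⟨shell ρ σ c (X j₀), by rw [hs0]; exact h0, ?_⟩
        simp only [if_neg hj]
        exact hf (X j₀)
    · intro j hj
      simp only [Set.mem_ofPred_eq] at hj
      simp only [if_neg hj, hs0, h0, if_true]
    · intro j hj
      simp only [Set.mem_ofPred_eq, not_not] at hj
      simp only [if_pos hj]
      exact hf' (X j)

/-- Uniform bound over all tuples of centres from a finite set. -/
theorem IsSensitivitySampling.measureReal_net_le (hk : 1 ≤ k) {r e B : ℝ} {A : Fin n → Pt d}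
    {p : Fin n → ℝ} (h : IsSensitivitySampling k r A p) (hr : 0 < r) (he : 0 ≤ e) (he1 : e ≤ 1)
    (hM : 0 < meanCost A) (P : Finset (Pt d)) (hkB : (k : ℝ) ≤ B) (hP : (P.card : ℝ) ≤ B) :
    (volume : Measure (Fin n → unitInterval)).real
      {u | ∃ Y : Fin k → Pt d, (∀ j, Y j ∈ P) ∧
        e * (cost Y A + meanCost A) < |deviation p (fun i => centerCost Y (A i)) u|} ≤
      (Real.exp 1 * (B / k)) ^ k * (2 * Real.exp (-(r * e ^ 2 / 4))) := by
  classical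
  set 𝒯 := P.powerset.filter fun T => T.card ≤ k with h𝒯
  let bad : (Fin k → Pt d) → Set (Fin n → unitInterval) := fun Y =>
    {u | e * (cost Y A + meanCost A) < |deviation p (fun i => centerCost Y (A i)) u|}
  -- The cost depends only on the set of centres, so the union bound runs over subsets of size at
  -- most `k`.
  have hbad : ∀ Y Z : Fin k → Pt d, Set.range Y = Set.range Z → bad Y = bad Z := by
    intro Y Z hYZ
    simp only [bad, cost, centerCost_congr_range hYZ]
  have hT : ∀ T ∈ 𝒯, (volume : Measure (Fin n → unitInterval)).real
      {u | ∃ Y : Fin k → Pt d, Set.range Y = T ∧ u ∈ bad Y} ≤ 2 * Real.exp (-(r * e ^ 2 / 4)) := by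
    intro T _
    by_cases hex : ∃ Z : Fin k → Pt d, Set.range Z = T
    · obtain ⟨Z, hZ⟩ := hex
      have hsub : {u | ∃ Y : Fin k → Pt d, Set.range Y = T ∧ u ∈ bad Y} ⊆ bad Z := by
        rintro u ⟨Y, hY, hu⟩
        rwa [hbad Z Y (hZ.trans hY.symm)]
      exact (measureReal_mono hsub).trans (h.measureReal_cost_le hr he he1 hM Z)
    · have hemp : {u | ∃ Y : Fin k → Pt d, Set.range Y = T ∧ u ∈ bad Y} = ∅ := by
        ext u
        simp only [Set.mem_ofPred_eq, Set.mem_empty_iff_false, iff_false]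
        rintro ⟨Y, hY, _⟩
        exact hex ⟨Y, hY⟩
      rw [hemp, measureReal_empty]
      positivity
  have hsub : {u | ∃ Y : Fin k → Pt d, (∀ j, Y j ∈ P) ∧ u ∈ bad Y} ⊆
      ⋃ T ∈ 𝒯, {u | ∃ Y : Fin k → Pt d, Set.range Y = T ∧ u ∈ bad Y} := by
    rintro u ⟨Y, hY, hu⟩
    refine Set.mem_iUnion₂.2 ⟨Finset.univ.image Y, ?_, Y, by simp, hu⟩
    rw [h𝒯, Finset.mem_filter, Finset.mem_powerset]
    refine ⟨fun x hx => ?_, Finset.card_image_le.trans (by simp)⟩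
    obtain ⟨j, _, rfl⟩ := Finset.mem_image.1 hx
    exact hY j
  calc _ ≤ _ := measureReal_mono hsub (measure_ne_top _ _)
    _ ≤ ∑ T ∈ 𝒯, _ := measureReal_biUnion_finset_le _ _
    _ ≤ ∑ T ∈ 𝒯, 2 * Real.exp (-(r * e ^ 2 / 4)) := Finset.sum_le_sum hT
    _ = 𝒯.card * (2 * Real.exp (-(r * e ^ 2 / 4))) := by rw [Finset.sum_const, nsmul_eq_mul]
    _ ≤ _ := by
        gcongr
        exact card_small_subsets_le P hk hkB hP

theorem deviation_eq (p b : Fin n → ℝ) (u : Fin n → unitInterval) :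
    deviation p b u = ∑ i, b i * (sampleWeight (p i) (u i) - 1) := rfl

theorem sum_mul_sampleWeight_le {A : Fin n → Pt d} {p : Fin n → ℝ} {u : Fin n → unitInterval}
    (h : |deviation p (fun i => ‖A i - prefixMean A n‖ ^ 2) u| ≤ meanCost A) :
    ∑ i, ‖A i - prefixMean A n‖ ^ 2 * sampleWeight (p i) (u i) ≤ 2 * meanCost A := by
  have h1 := (abs_le.1 h).2
  simp only [deviation_eq, mul_sub, mul_one, Finset.sum_sub_distrib] at h1
  rw [← meanCost_eq] at h1
  linarith

/-- The sampled mean cost of at most `k` light windows is small. -/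
theorem sum_windowSum_sampleWeight_le {ρ σ e : ℝ} {A : Fin n → Pt d} {p : Fin n → ℝ}
    {u : Fin n → unitInterval} (hk : 1 ≤ k) (he : 0 < e) (hM : 0 < meanCost A)
    (hu : ∑ s ∈ Finset.range (shellBound ρ σ (prefixMean A n) A),
      windowDeviation ρ σ A p s u ^ 2 ≤ e * meanCost A / k * (e * meanCost A))
    {S : Finset ℕ} (hS : S.card ≤ k) (hlight : ∀ s ∈ S,
      windowSum ρ σ (prefixMean A n) A (fun i => ‖A i - prefixMean A n‖ ^ 2) s ≤
        e * meanCost A / k) :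
    ∑ s ∈ S, windowSum ρ σ (prefixMean A n) A (fun i => ‖A i - prefixMean A n‖ ^ 2) s ≤
        e * meanCost A ∧
      ∑ s ∈ S, windowSum ρ σ (prefixMean A n) A
        (fun i => ‖A i - prefixMean A n‖ ^ 2 * sampleWeight (p i) (u i)) s ≤
          3 * e * meanCost A := by
  have hk0 : (0 : ℝ) < k := by exact_mod_cast hk
  obtain ⟨τ, hτ⟩ : ∃ τ, τ = e * meanCost A / k := ⟨_, rfl⟩
  have hτ0 : 0 < τ := by rw [hτ]; positivity
  have hkτ : k * τ = e * meanCost A := by rw [hτ]; field_simp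
  rw [← hτ] at hu hlight
  have hSk : (S.card : ℝ) * τ ≤ e * meanCost A := by
    rw [← hkτ]
    gcongr
  constructor
  · calc _ ≤ ∑ _s ∈ S, τ := Finset.sum_le_sum hlight
      _ = S.card * τ := by rw [Finset.sum_const, nsmul_eq_mul]
      _ ≤ _ := hSk
  · have hterm : ∀ s ∈ S, windowSum ρ σ (prefixMean A n) A
        (fun i => ‖A i - prefixMean A n‖ ^ 2 * sampleWeight (p i) (u i)) s ≤
        2 * τ + windowDeviation ρ σ A p s u ^ 2 / τ := by
      intro s hs
      rw [windowSum_mul_sampleWeight]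
      have h1 := hlight s hs
      -- Trades the deviation for its square, the only quantity controlled jointly over all windows.
      have h2 : windowDeviation ρ σ A p s u ≤ τ + windowDeviation ρ σ A p s u ^ 2 / τ := by
        have h3 : τ + windowDeviation ρ σ A p s u ^ 2 / τ =
            (τ ^ 2 + windowDeviation ρ σ A p s u ^ 2) / τ := by field_simp
        rw [h3, le_div_iff₀ hτ0]
        nlinarith [sq_nonneg (windowDeviation ρ σ A p s u - τ),
          sq_nonneg (windowDeviation ρ σ A p s u), sq_nonneg τ]
      linarith
    have hdev : ∑ s ∈ S, windowDeviation ρ σ A p s u ^ 2 ≤ τ * (e * meanCost A) := by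
      refine le_trans ?_ hu
      -- `S` may contain shells beyond `shellBound`; their windows contain no points and contribute
      -- zero.
      rw [Finset.sum_subset (Finset.subset_union_right (s₁ := S)
        (s₂ := Finset.range (shellBound ρ σ (prefixMean A n) A)))]
      · exact Finset.sum_le_sum_of_subset_of_nonneg Finset.subset_union_left
          fun s _ _ => sq_nonneg _
      · intro s _ hs
        rw [Finset.mem_range, not_lt] at hs
        rw [windowDeviation_eq_zero p hs]
        norm_num
    calc _ ≤ ∑ s ∈ S, (2 * τ + windowDeviation ρ σ A p s u ^ 2 / τ) := Finset.sum_le_sum hterm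
      _ = 2 * (S.card * τ) + (∑ s ∈ S, windowDeviation ρ σ A p s u ^ 2) / τ := by
          rw [Finset.sum_add_distrib, Finset.sum_const, nsmul_eq_mul, Finset.sum_div]; ring
      _ ≤ 2 * (e * meanCost A) + τ * (e * meanCost A) / τ := by gcongr
      _ = _ := by field_simp; ring

theorem one_le_of_mul_sq_ge {r e : ℝ} (he : 0 < e) (he1 : e ≤ 1 / 2) (hk : 1 ≤ k)
    (hr : 12000 * k ≤ r * e ^ 2) : 1 ≤ r := by
  have hk' : (1 : ℝ) ≤ k := by exact_mod_cast hk
  by_contra! h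
  have : r * e ^ 2 ≤ 1 * e ^ 2 := by gcongr
  nlinarith

/-- Sampling with probabilities that dominate the sensitivities preserves the costs of all
`k`-tuples of centres. -/
theorem IsSensitivitySampling.le_measureReal (hk : 1 ≤ k) {r e : ℝ} {A : Fin n → Pt d}
    {p : Fin n → ℝ} (h : IsSensitivitySampling k r A p) (he : 0 < e) (he1 : e ≤ 1 / 2)
    (hr : 12000 * k ≤ r * e ^ 2)
    (hr' : (Real.exp 1 * (5 / e * (1 + 18 / e ^ 3) ^ d)) ^ k *
      (2 * Real.exp (-(r * e ^ 2 / 4))) ≤ 1 / 500) :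
    0.99 ≤ (volume : Measure (Fin n → unitInterval)).real {u | ∀ X : Fin k → Pt d,
      |deviation p (fun i => centerCost X (A i)) u| ≤ 110 * e * (cost X A + meanCost A)} := by
  have hk0 : (0 : ℝ) < k := by exact_mod_cast hk
  have hr1 := one_le_of_mul_sq_ge he he1 hk hr
  have hr0 : 0 < r := by linarith
  -- The number of candidate sets in `hr'` is bounded by a quantity at least `1`, so `hr'` also
  -- covers a single event.
  have hexp : 2 * Real.exp (-(r * e ^ 2 / 4)) ≤ 1 / 500 := by
    refine le_trans ?_ hr'
    refine le_mul_of_one_le_left (by positivity) (one_le_pow₀ ?_)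
    have h1 : 1 ≤ Real.exp 1 := Real.one_le_exp zero_le_one
    have h2 : 1 ≤ 5 / e := by rw [le_div_iff₀ he]; linarith
    have h3 : 1 ≤ (1 + 18 / e ^ 3) ^ d := one_le_pow₀ (by simp; positivity)
    exact one_le_mul_of_one_le_of_one_le h1 (one_le_mul_of_one_le_of_one_le h2 h3)
  set good := {u : Fin n → unitInterval | ∀ X : Fin k → Pt d,
    |deviation p (fun i => centerCost X (A i)) u| ≤ 110 * e * (cost X A + meanCost A)} with hgood
  have hcount := h.measureReal_count_le hr0 he.le (by linarith)
  set badCount := {u : Fin n → unitInterval | e * n < |deviation p (fun _ => 1) u|} with hbadCount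
  have hfar : ∀ (u : Fin n → unitInterval), u ∉ badCount →
      |deviation p (fun i => ‖A i - prefixMean A n‖ ^ 2) u| ≤ meanCost A →
      ∀ X : Fin k → Pt d, (∀ j, 9 * meanCost A ≤ e ^ 2 * (n * ‖prefixMean A n - X j‖ ^ 2)) →
      |deviation p (fun i => centerCost X (A i)) u| ≤ 110 * e * (cost X A + meanCost A) := by
    intro u hu hu' X hX
    have h1 : |∑ i, (sampleWeight (p i) (u i) - 1)| ≤ e * n := by
      simpa [hbadCount, deviation_eq] using hu
    refine (abs_sum_centerCost_le_of_far hk A (fun i => sampleWeight_nonneg (h.pos i) (u i)) he he1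
      X hX h1 (sum_mul_sampleWeight_le hu')).trans ?_
    have := cost_nonneg X A
    have := meanCost_nonneg A
    gcongr
    norm_num
  -- If all points coincide there is no scale `σ`, but then every `X` meets the condition of the far
  -- case.
  rcases (meanCost_nonneg A).eq_or_lt with hM | hM
  · have hm : ∀ i, ‖A i - prefixMean A n‖ ^ 2 = 0 := by
      intro i
      have := (Finset.sum_eq_zero_iff_of_nonneg
        (fun i _ => sq_nonneg ‖A i - prefixMean A n‖)).1 ((meanCost_eq A).symm.trans hM.symm)
      exact this i (Finset.mem_univ i)
    have hcover : Set.univ ⊆ good ∪ badCount := by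
      intro u _
      by_cases hu : u ∈ badCount
      · exact Or.inr hu
      · refine Or.inl fun X => hfar u hu ?_ X fun j => ?_
        · simp only [hm, deviation_eq, zero_mul, Finset.sum_const_zero, abs_zero, ← hM, le_refl]
        · rw [← hM, mul_zero]; positivity
    have h1 := measureReal_mono (μ := (volume : Measure (Fin n → unitInterval))) hcover
    rw [probReal_univ] at h1
    have h2 := measureReal_union_le (μ := (volume : Measure (Fin n → unitInterval))) good badCount
    linarith
  · have hn : (0 : ℝ) < n := by
      rcases Nat.eq_zero_or_pos n with rfl | hn
      · simp [meanCost] at hM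
      · exact_mod_cast hn
    obtain ⟨σ, hσ⟩ : ∃ σ, σ = Real.sqrt (meanCost A / n) := ⟨_, rfl⟩
    have hσ0 : 0 < σ := by rw [hσ]; positivity
    have hσM : σ ^ 2 * n = meanCost A := by
      rw [hσ, Real.sq_sqrt (by positivity)]; field_simp
    obtain ⟨ρ, hρ⟩ : ∃ ρ, ρ = 3 / e := ⟨_, rfl⟩
    have hρe : ρ * e = 3 := by rw [hρ]; field_simp
    -- At most `k` shells contain centres, so light windows of cost at most `τ` add up to at most `e
    -- * meanCost A`.
    obtain ⟨τ, hτ⟩ : ∃ τ, τ = e * meanCost A / k := ⟨_, rfl⟩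
    have hτ0 : 0 < τ := by rw [hτ]; positivity
    have hH0 : 0 ∈ heavyShells ρ σ τ A := by simp [heavyShells]
    obtain ⟨P, hPcard, hP⟩ := exists_rounding_net (k := k) hσ0 he he1 hρ (prefixMean A n)
      (heavyShells ρ σ τ A) hH0
    have hQ : 1 ≤ (1 + 18 / e ^ 3) ^ d := one_le_pow₀ (by simp; positivity)
    have hek : (k : ℝ) ≤ k / e := by rw [le_div_iff₀ he]; nlinarith
    have hHcard : ((heavyShells ρ σ τ A).card : ℝ) ≤ 5 * k / e := by
      have h1 := card_heavyShells_le ρ σ hτ0 A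
      have h2 : 3 * meanCost A / τ = 3 * (k / e) := by rw [hτ]; field_simp
      have h3 : (1 : ℝ) ≤ k := by exact_mod_cast hk
      rw [h2] at h1
      have h4 : 5 * k / e = 5 * (k / e) := by ring
      linarith
    have hnet := h.measureReal_net_le hk hr0 he.le (by linarith) hM P
      (B := 5 * k / e * (1 + 18 / e ^ 3) ^ d)
      (by
        have h4 : 5 * k / e = 5 * (k / e) := by ring
        have h5 : (k : ℝ) ≤ 5 * k / e := by rw [h4]; linarith
        exact h5.trans (le_mul_of_one_le_right (by positivity) hQ))
      (hPcard.trans (by gcongr))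
    -- Here `k` disappears from the base of the union bound.
    have hBk : 5 * k / e * (1 + 18 / e ^ 3) ^ d / k = 5 / e * (1 + 18 / e ^ 3) ^ d := by field_simp
    rw [hBk] at hnet
    have hmean := h.measureReal_mean_le hk hr0 hM
    have hmean' : 2 * Real.exp (-(r * (1 / 2) ^ 2 / 4)) ≤ 1 / 500 := by
      refine le_trans ?_ hexp
      gcongr
    have hwin := h.measureReal_window_le hk hr1 hM ρ σ (δ := τ * (e * meanCost A)) (by positivity)
      (Finset.range (shellBound ρ σ (prefixMean A n) A))
    have hwin' : 24 * meanCost A ^ 2 / (r * (τ * (e * meanCost A))) ≤ 1 / 500 := by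
      have h1 : 24 * meanCost A ^ 2 / (r * (τ * (e * meanCost A))) = 24 * k / (r * e ^ 2) := by
        rw [hτ]; field_simp
      rw [h1, div_le_iff₀ (by positivity)]
      linarith
    set badNet := {u : Fin n → unitInterval | ∃ Y : Fin k → Pt d, (∀ j, Y j ∈ P) ∧
        e * (cost Y A + meanCost A) < |deviation p (fun i => centerCost Y (A i)) u|} with hbadNet
    set badMean := {u : Fin n → unitInterval |
      meanCost A < |deviation p (fun i => ‖A i - prefixMean A n‖ ^ 2) u|} with hbadMean
    set badWin := {u : Fin n → unitInterval | τ * (e * meanCost A) ≤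
      ∑ s ∈ Finset.range (shellBound ρ σ (prefixMean A n) A),
        windowDeviation ρ σ A p s u ^ 2} with hbadWin
    have hcover : Set.univ ⊆ good ∪ badCount ∪ badNet ∪ badMean ∪ badWin := by
      intro u _
      by_cases hu1 : u ∈ badCount
      · exact Or.inl (Or.inl (Or.inl (Or.inr hu1)))
      by_cases hu2 : u ∈ badNet
      · exact Or.inl (Or.inl (Or.inr hu2))
      by_cases hu3 : u ∈ badMean
      · exact Or.inl (Or.inr hu3)
      by_cases hu4 : u ∈ badWin
      · exact Or.inr hu4
      refine Or.inl (Or.inl (Or.inl (Or.inl fun X => ?_)))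
      have hu3' : |deviation p (fun i => ‖A i - prefixMean A n‖ ^ 2) u| ≤ meanCost A := by
        simpa [hbadMean] using hu3
      -- The threshold is the one of the far case, because `e² n (ρ σ)² = 9 * meanCost A`.
      by_cases hX : ∀ j, ρ * σ ≤ ‖X j - prefixMean A n‖
      · refine hfar u hu1 hu3' X fun j => ?_
        rw [norm_sub_rev]
        calc 9 * meanCost A = e ^ 2 * (n * (ρ * σ) ^ 2) := by
              rw [← hσM]
              linear_combination (-(σ ^ 2 * n) * (ρ * e + 3)) * hρe
          _ ≤ _ := by
              have := hX j
              have : 0 < ρ := by rw [hρ]; positivity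
              gcongr
      · push Not at hX
        obtain ⟨j₀, hj₀⟩ := hX
        obtain ⟨Y, hYP, hY⟩ := hP X j₀ hj₀
        have hcnt : |∑ i, (sampleWeight (p i) (u i) - 1)| ≤ e * n := by
          simpa [hbadCount, deviation_eq] using hu1
        have hYdev : |deviation p (fun i => centerCost Y (A i)) u| ≤
            e * (cost Y A + meanCost A) := by
          by_contra! hcon
          exact hu2 ⟨Y, hYP, hcon⟩
        have hu4' : ∑ s ∈ Finset.range (shellBound ρ σ (prefixMean A n) A),
            windowDeviation ρ σ A p s u ^ 2 ≤ τ * (e * meanCost A) := by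
          by_contra! hcon
          exact hu4 hcon.le
        rw [hτ] at hu4'
        set S := (Finset.univ.image fun j => shell ρ σ (prefixMean A n) (X j)).filter
          fun s => s ∉ heavyShells ρ σ τ A with hS
        have hScard : S.card ≤ k :=
          (Finset.card_filter_le _ _).trans (Finset.card_image_le.trans (by simp))
        have hl := sum_windowSum_sampleWeight_le hk he hM hu4' hScard fun s hs => by
          rw [← hτ]
          exact windowSum_le_of_notMem_heavyShells hτ0.le (Finset.mem_filter.1 hs).2
        exact hY.abs_sum_centerCost_le (fun s hs => two_le_of_notMem_heavyShells hs) hσ0 he he1 hρ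
          hσM (S := S)
          (fun j hj => Finset.mem_filter.2 ⟨Finset.mem_image_of_mem _ (Finset.mem_univ j), hj⟩)
          (fun i => sampleWeight_nonneg (h.pos i) (u i)) hYdev hcnt (sum_mul_sampleWeight_le hu3')
          hl.1 hl.2
    -- Four bad events of probability at most `1 / 500` each, `0.008` in all.
    have h1 := measureReal_mono (μ := (volume : Measure (Fin n → unitInterval))) hcover
    rw [probReal_univ] at h1
    have h2 := measureReal_union_le (μ := (volume : Measure (Fin n → unitInterval))) good badCount
    have h3 := measureReal_union_le (μ := (volume : Measure (Fin n → unitInterval)))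
      (good ∪ badCount) badNet
    have h4 := measureReal_union_le (μ := (volume : Measure (Fin n → unitInterval)))
      (good ∪ badCount ∪ badNet) badMean
    have h5 := measureReal_union_le (μ := (volume : Measure (Fin n → unitInterval)))
      (good ∪ badCount ∪ badNet ∪ badMean) badWin
    linarith

end Uniform

/-! ### The states of the algorithm -/

section Algorithm

variable {n d k : ℕ}

theorem sum_filter_lt_succ {M : Type*} [AddCommMonoid M] (f : Fin n → M) {m : ℕ} (hm : m < n) :
    ∑ j : Fin n with j.val < m + 1, f j = (∑ j : Fin n with j.val < m, f j) + f ⟨m, hm⟩ := by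
  have h : (Finset.univ.filter fun j : Fin n => j.val < m + 1) =
      insert ⟨m, hm⟩ (Finset.univ.filter fun j : Fin n => j.val < m) := by
    ext j
    simp only [Finset.mem_filter, Finset.mem_univ, true_and, Finset.mem_insert, Fin.ext_iff]
    omega
  rw [h, Finset.sum_insert (by simp), add_comm]

theorem sum_filter_lt_self {M : Type*} [AddCommMonoid M] (f : Fin n → M) :
    ∑ j : Fin n with j.val < n, f j = ∑ j, f j := by
  congr 1
  ext j
  simp

theorem smul_prefixMean {A : Fin n → Pt d} {m : ℕ} :
    (m : ℝ) • prefixMean A m = ∑ j : Fin n with j.val < m, A j := by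
  rcases Nat.eq_zero_or_pos m with rfl | hm
  · simp
  · rw [prefixMean, smul_smul, mul_inv_cancel₀ (by positivity), one_smul]

theorem prefixMean_succ (A : Fin n → Pt d) {m : ℕ} (hm : m < n) :
    prefixMean A (m + 1) = ((m : ℝ) + 1)⁻¹ • ((m : ℝ) • prefixMean A m + A ⟨m, hm⟩) := by
  rw [smul_prefixMean, ← sum_filter_lt_succ A hm, prefixMean]
  push_cast
  rfl

/-- The value of the running sum `S` after `m` points. -/
noncomputable def runningTotal (A : Fin n → Pt d) (m : ℕ) : ℝ :=
  ∑ j : Fin n with j.val < m, sqDist (prefixMean A (j + 1)) (A j)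

/-- The probability with which the point `A i` is sampled. -/
noncomputable def streamProb (r : ℝ) (A : Fin n → Pt d) (i : Fin n) : ℝ :=
  if i.val = 0 then 1
  -- Indices start at `0`, so `(i : ℕ)` is the number of earlier points.
  else min 1 (r * (2 * sqDist (prefixMean A (i + 1)) (A i) / runningTotal A (i + 1) + 8 / (i : ℕ)))

/-- The state after `m` points. -/
noncomputable def stateAfter (r : ℝ) (A : Fin n → Pt d) (u : Fin n → unitInterval) (m : ℕ) :
    FilterState d :=
  ((List.ofFn fun i => (A i, u i)).take m).foldl (filterStep r) (FilterState.init d)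

theorem stateAfter_succ (r : ℝ) (A : Fin n → Pt d) (u : Fin n → unitInterval) {m : ℕ}
    (hm : m < n) : stateAfter r A u (m + 1) =
      filterStep r (stateAfter r A u m) (A ⟨m, hm⟩, u ⟨m, hm⟩) := by
  unfold stateAfter
  rw [List.take_succ_eq_append_getElem (by simpa using hm), List.foldl_append]
  simp

theorem coresetOf_eq_stateAfter (r : ℝ) (A : Fin n → Pt d) (u : Fin n → unitInterval) :
    coresetOf r A u = (stateAfter r A u n).coreset := by
  unfold coresetOf parametricFilter stateAfter
  rw [List.take_of_length_le (by simp)]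

/-- None of these three components involves `u`; hence the sampling probabilities are deterministic
and the choices independent. -/
theorem stateAfter_spec (r : ℝ) (A : Fin n → Pt d) (u : Fin n → unitInterval) {m : ℕ}
    (hm : m ≤ n) : (stateAfter r A u m).count = m ∧
      (stateAfter r A u m).mean = prefixMean A m ∧
      (stateAfter r A u m).total = runningTotal A m := by
  induction m with
  | zero => simp [stateAfter, FilterState.init, prefixMean, runningTotal]
  | succ m ih =>
    obtain ⟨h1, h2, h3⟩ := ih (by omega)
    have hmean : newMean (stateAfter r A u m) (A ⟨m, hm⟩) = prefixMean A (m + 1) := by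
      rw [newMean, h1, h2, prefixMean_succ A hm]
    rw [stateAfter_succ r A u hm]
    refine ⟨by simp [filterStep, h1], hmean, ?_⟩
    show newTotal _ _ = _
    rw [newTotal, hmean, h3, runningTotal, runningTotal, sum_filter_lt_succ _ hm]

theorem sampleProb_stateAfter (r : ℝ) (A : Fin n → Pt d) (u : Fin n → unitInterval) {m : ℕ}
    (hm : m < n) :
    sampleProb r (stateAfter r A u m) (A ⟨m, hm⟩) = streamProb r A ⟨m, hm⟩ := by
  obtain ⟨h1, h2, h3⟩ := stateAfter_spec r A u hm.le
  have hmean : newMean (stateAfter r A u m) (A ⟨m, hm⟩) = prefixMean A (m + 1) := by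
    rw [newMean, h1, h2, prefixMean_succ A hm]
  have htot : newTotal (stateAfter r A u m) (A ⟨m, hm⟩) = runningTotal A (m + 1) := by
    rw [newTotal, hmean, h3, runningTotal, runningTotal, sum_filter_lt_succ _ hm]
  rw [sampleProb, streamProb, hmean, htot, h1]

theorem weightedCost_coresetOf (r : ℝ) (A : Fin n → Pt d) (u : Fin n → unitInterval)
    (X : Fin k → Pt d) :
    weightedCost X (coresetOf r A u) =
      ∑ i, centerCost X (A i) * sampleWeight (streamProb r A i) (u i) := by
  have key : ∀ m ≤ n, weightedCost X (stateAfter r A u m).coreset =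
      ∑ i : Fin n with i.val < m, centerCost X (A i) * sampleWeight (streamProb r A i) (u i) := by
    intro m
    induction m with
    | zero => simp [stateAfter, FilterState.init, weightedCost]
    | succ m ih =>
      intro hm
      rw [stateAfter_succ r A u hm, sum_filter_lt_succ _ hm, ← ih (by omega)]
      simp only [filterStep, sampleProb_stateAfter, sampleWeight]
      split_ifs
      · simp [weightedCost, mul_comm]
      · simp
  rw [coresetOf_eq_stateAfter, key n le_rfl, sum_filter_lt_self]

theorem length_coresetOf (r : ℝ) (A : Fin n → Pt d) (u : Fin n → unitInterval) :
    ((coresetOf r A u).length : ℝ) = ∑ i, if (u i : ℝ) ≤ streamProb r A i then 1 else 0 := by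
  have key : ∀ m ≤ n, ((stateAfter r A u m).coreset.length : ℝ) =
      ∑ i : Fin n with i.val < m, if (u i : ℝ) ≤ streamProb r A i then 1 else 0 := by
    intro m
    induction m with
    | zero => simp [stateAfter, FilterState.init]
    | succ m ih =>
      intro hm
      rw [stateAfter_succ r A u hm, sum_filter_lt_succ _ hm, ← ih (by omega)]
      simp only [filterStep, sampleProb_stateAfter]
      split_ifs <;> simp
  rw [coresetOf_eq_stateAfter, key n le_rfl, sum_filter_lt_self]

theorem weightedCost_sub_cost (r : ℝ) (A : Fin n → Pt d) (u : Fin n → unitInterval)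
    (X : Fin k → Pt d) :
    weightedCost X (coresetOf r A u) - cost X A =
      deviation (streamProb r A) (fun i => centerCost X (A i)) u := by
  rw [weightedCost_coresetOf, cost, ← Finset.sum_sub_distrib, deviation]
  exact Finset.sum_congr rfl fun i _ => by ring

/-! ### Sensitivities -/

/-- The cost of the first `m` points with respect to their mean. -/
noncomputable def prefixCost (A : Fin n → Pt d) (m : ℕ) : ℝ :=
  ∑ j : Fin n with j.val < m, ‖A j - prefixMean A m‖ ^ 2

/-- Optimality of the mean: in the expansion around it the cross terms sum to zero. -/
theorem prefixCost_le (A : Fin n → Pt d) {m : ℕ} (hm : m ≤ n) (y : Pt d) :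
    prefixCost A m ≤ ∑ j : Fin n with j.val < m, ‖A j - y‖ ^ 2 := by
  have hcard : (Finset.univ.filter fun j : Fin n => j.val < m).card = m := by
    rw [Fin.card_filter_val_lt, min_eq_right hm]
  have hzero : ∑ j : Fin n with j.val < m, (A j - prefixMean A m) = 0 := by
    rw [Finset.sum_sub_distrib, Finset.sum_const, hcard, ← smul_prefixMean, Nat.cast_smul_eq_nsmul,
      sub_self]
  have hinner : ∑ j : Fin n with j.val < m, inner ℝ (A j - prefixMean A m) (prefixMean A m - y) =
      0 := by
    rw [← sum_inner, hzero, inner_zero_left]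
  have hexp : ∀ j, ‖A j - y‖ ^ 2 = ‖A j - prefixMean A m‖ ^ 2 +
      2 * inner ℝ (A j - prefixMean A m) (prefixMean A m - y) + ‖prefixMean A m - y‖ ^ 2 := by
    intro j
    rw [← norm_add_sq_real, sub_add_sub_cancel]
  simp_rw [hexp]
  rw [Finset.sum_add_distrib, Finset.sum_add_distrib, ← Finset.mul_sum, hinner, mul_zero, add_zero]
  exact le_add_of_nonneg_right (Finset.sum_nonneg fun _ _ => sq_nonneg _)

theorem prefixCost_add_le (A : Fin n → Pt d) {m : ℕ} (hm : m < n) :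
    prefixCost A m + sqDist (prefixMean A (m + 1)) (A ⟨m, hm⟩) ≤ prefixCost A (m + 1) := by
  conv_rhs => rw [prefixCost, sum_filter_lt_succ _ hm]
  exact add_le_add_left (prefixCost_le A hm.le _) _

theorem runningTotal_succ (A : Fin n → Pt d) {m : ℕ} (hm : m < n) :
    runningTotal A (m + 1) = runningTotal A m + sqDist (prefixMean A (m + 1)) (A ⟨m, hm⟩) := by
  rw [runningTotal, runningTotal, sum_filter_lt_succ _ hm]

theorem runningTotal_nonneg (A : Fin n → Pt d) (m : ℕ) : 0 ≤ runningTotal A m :=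
  Finset.sum_nonneg fun _ _ => sqDist_nonneg _ _

/-- When a point arrives, the optimal cost grows at least by the increment of `S`, since the new
mean is no better than the old one for the earlier points. -/
theorem runningTotal_le_prefixCost (A : Fin n → Pt d) {m : ℕ} (hm : m ≤ n) :
    runningTotal A m ≤ prefixCost A m := by
  induction m with
  | zero => simp [runningTotal, prefixCost]
  | succ m ih =>
    rw [runningTotal_succ A hm]
    exact (add_le_add_left (ih (by omega)) _).trans (prefixCost_add_le A hm)

theorem prefixCost_le_meanCost (A : Fin n → Pt d) {m : ℕ} (hm : m ≤ n) :
    prefixCost A m ≤ meanCost A := by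
  refine (prefixCost_le A hm (prefixMean A n)).trans ?_
  rw [meanCost_eq]
  exact Finset.sum_le_sum_of_subset_of_nonneg (Finset.filter_subset _ _) fun _ _ _ => sq_nonneg _

theorem runningTotal_le_meanCost (A : Fin n → Pt d) {m : ℕ} (hm : m ≤ n) :
    runningTotal A m ≤ meanCost A :=
  (runningTotal_le_prefixCost A hm).trans (prefixCost_le_meanCost A hm)

/-- Each of the first `m` points gives a bound on the cost of their mean by the relaxed triangle
inequality; add these bounds. -/
theorem mul_centerCost_prefixMean_le (hk : 1 ≤ k) (A : Fin n → Pt d) (X : Fin k → Pt d) {m : ℕ}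
    (hm : m ≤ n) : m * centerCost X (prefixMean A m) ≤ 2 * (cost X A + meanCost A) := by
  have hcard : (Finset.univ.filter fun j : Fin n => j.val < m).card = m := by
    rw [Fin.card_filter_val_lt, min_eq_right hm]
  calc m * centerCost X (prefixMean A m)
      = ∑ j : Fin n with j.val < m, centerCost X (prefixMean A m) := by
        rw [Finset.sum_const, hcard, nsmul_eq_mul]
    _ ≤ ∑ j : Fin n with j.val < m, (2 * centerCost X (A j) + 2 * ‖A j - prefixMean A m‖ ^ 2) := by
        refine Finset.sum_le_sum fun j _ => ?_
        have := centerCost_le_two_mul hk X (prefixMean A m) (A j)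
        rwa [norm_sub_rev] at this
    _ = 2 * (∑ j : Fin n with j.val < m, centerCost X (A j)) + 2 * prefixCost A m := by
        rw [Finset.sum_add_distrib, ← Finset.mul_sum, ← Finset.mul_sum, prefixCost]
    _ ≤ 2 * cost X A + 2 * meanCost A := by
        gcongr
        · exact Finset.sum_le_sum_of_subset_of_nonneg (Finset.filter_subset _ _)
            fun _ _ _ => centerCost_nonneg _ _
        · exact prefixCost_le_meanCost A hm
    _ = _ := by ring

theorem centerCost_le_sensitivity (hk : 1 ≤ k) (A : Fin n → Pt d) (X : Fin k → Pt d) (i : Fin n)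
    (hi : i.val ≠ 0) :
    centerCost X (A i) ≤ (2 * sqDist (prefixMean A (i + 1)) (A i) / runningTotal A (i + 1) +
      8 / (i : ℕ)) * (cost X A + meanCost A) := by
  set F := cost X A + meanCost A with hF
  have hX := cost_nonneg X A
  have hM := meanCost_nonneg A
  have hF0 : 0 ≤ F := by positivity
  have hi0 : (0 : ℝ) < (i : ℕ) := by exact_mod_cast Nat.pos_of_ne_zero hi
  obtain ⟨q, hq⟩ : ∃ q, q = sqDist (prefixMean A (i + 1)) (A i) := ⟨_, rfl⟩
  have hq0 : 0 ≤ q := hq ▸ sqDist_nonneg _ _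
  have h1 : centerCost X (A i) ≤ 2 * centerCost X (prefixMean A (i + 1)) + 2 * q := by
    rw [hq]; exact centerCost_le_two_mul hk X _ _
  have h2 := mul_centerCost_prefixMean_le hk A X (m := i + 1) i.isLt
  have h0 := centerCost_nonneg X (prefixMean A (i + 1))
  have h3 : centerCost X (prefixMean A (i + 1)) ≤ 2 * F / (i : ℕ) := by
    rw [le_div_iff₀ hi0]
    push_cast at h2
    linarith
  have h4 : 2 * q ≤ 2 * q / runningTotal A (i + 1) * F := by
    have hs := runningTotal_succ A i.isLt
    have hs0 := runningTotal_nonneg A i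
    change _ = _ + sqDist (prefixMean A (i + 1)) (A i) at hs
    rw [← hq] at hs
    have hSF : runningTotal A (i + 1) ≤ F :=
      (runningTotal_le_meanCost A (m := i + 1) i.isLt).trans (le_add_of_nonneg_left hX)
    -- Only for `q = 0` can the denominator vanish, and then both sides are zero.
    rcases hq0.eq_or_lt with h | h
    · rw [← h]; simp
    · have hS : 0 < runningTotal A (i + 1) := by linarith
      rw [div_mul_eq_mul_div, le_div_iff₀ hS]
      gcongr
  have h5 : 8 / ((i : ℕ) : ℝ) * F = 4 * (2 * F / (i : ℕ)) := by ring
  have h6 : 0 ≤ 2 * F / ((i : ℕ) : ℝ) := by positivity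
  rw [← hq, add_mul, h5]
  linarith

theorem streamProb_pos {r : ℝ} (hr : 0 < r) (A : Fin n → Pt d) (i : Fin n) :
    0 < streamProb r A i := by
  unfold streamProb
  split_ifs with h
  · exact zero_lt_one
  · have hi0 : (0 : ℝ) < (i : ℕ) := by exact_mod_cast Nat.pos_of_ne_zero h
    have := div_nonneg (mul_nonneg zero_le_two (sqDist_nonneg (prefixMean A (i + 1)) (A i)))
      (runningTotal_nonneg A (i + 1))
    refine lt_min zero_lt_one ?_
    positivity

theorem streamProb_le_one (r : ℝ) (A : Fin n → Pt d) (i : Fin n) : streamProb r A i ≤ 1 := by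
  unfold streamProb
  split_ifs
  · exact le_rfl
  · exact min_le_left _ _

theorem isSensitivitySampling_streamProb (hk : 1 ≤ k) {r : ℝ} (hr : 0 < r) (A : Fin n → Pt d) :
    IsSensitivitySampling k r A (streamProb r A) where
  pos := streamProb_pos hr A
  le_one := streamProb_le_one r A
  count i := by
    unfold streamProb
    split_ifs with h
    · exact Or.inl rfl
    · rcases min_choice 1 (r * (2 * sqDist (prefixMean A (i + 1)) (A i) /
        runningTotal A (i + 1) + 8 / (i : ℕ))) with h1 | h1
      · exact Or.inl h1
      · right
        have hi0 : (0 : ℝ) < (i : ℕ) := by exact_mod_cast Nat.pos_of_ne_zero h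
        have hin : ((i : ℕ) : ℝ) ≤ n := by exact_mod_cast i.isLt.le
        have h2 := div_nonneg (mul_nonneg zero_le_two (sqDist_nonneg (prefixMean A (i + 1)) (A i)))
          (runningTotal_nonneg A (i + 1))
        have h3 : 1 ≤ 8 / ((i : ℕ) : ℝ) * n := by
          rw [div_mul_eq_mul_div, le_div_iff₀ hi0]; linarith
        rw [h1, mul_assoc]
        refine le_mul_of_one_le_right hr.le (h3.trans ?_)
        gcongr
        linarith
  sens i := by
    unfold streamProb
    split_ifs with h
    · exact Or.inl rfl
    · rcases min_choice 1 (r * (2 * sqDist (prefixMean A (i + 1)) (A i) /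
        runningTotal A (i + 1) + 8 / (i : ℕ))) with h1 | h1
      · exact Or.inl h1
      · refine Or.inr fun X => ?_
        rw [h1, mul_assoc]
        exact mul_le_mul_of_nonneg_left (centerCost_le_sensitivity hk A X i h) hr.le

end Algorithm

/-! ### The expected size of the coreset -/

section Size

variable {n d k : ℕ}

theorem measurable_threshold (p : ℝ) :
    Measurable fun u : unitInterval => if (u : ℝ) ≤ p then (1 : ℝ) else 0 :=
  Measurable.ite (measurableSet_le measurable_subtype_coe measurable_const) measurable_const
    measurable_const

theorem integrable_threshold (p : ℝ) (i : Fin n) :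
    Integrable fun u : Fin n → unitInterval => if (u i : ℝ) ≤ p then (1 : ℝ) else 0 := by
  refine Integrable.of_bound
    ((measurable_threshold p).comp (measurable_pi_apply i)).aestronglyMeasurable 1 ?_
  refine Filter.Eventually.of_forall fun u => ?_
  split_ifs <;> simp

theorem integrable_length_coresetOf (r : ℝ) (A : Fin n → Pt d) :
    Integrable fun u : Fin n → unitInterval => ((coresetOf r A u).length : ℝ) := by
  simp_rw [length_coresetOf]
  exact integrable_finsetSum _ fun i _ => integrable_threshold _ i

theorem integral_length_coresetOf {r : ℝ} (hr : 0 < r) (A : Fin n → Pt d) :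
    ∫ u : Fin n → unitInterval, ((coresetOf r A u).length : ℝ) = ∑ i, streamProb r A i := by
  simp_rw [length_coresetOf]
  rw [integral_finsetSum _ fun i _ => integrable_threshold _ i]
  refine Finset.sum_congr rfl fun i _ => ?_
  have h1 := integral_comp_eval (μ := fun _ : Fin n => (volume : Measure unitInterval)) (i := i)
    (measurable_threshold (streamProb r A i)).aestronglyMeasurable
  rw [← volume_pi] at h1
  rw [h1, integral_comp_threshold (streamProb_pos hr A i).le (streamProb_le_one r A i)]
  simp

theorem prefixMean_one (A : Fin n → Pt d) (hn : 0 < n) : prefixMean A 1 = A ⟨0, hn⟩ := by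
  rw [← zero_add 1, prefixMean_succ A hn]
  simp

theorem runningTotal_two (A : Fin n → Pt d) (h₁ : 1 < n) :
    runningTotal A 2 = sqDist (prefixMean A 2) (A ⟨1, h₁⟩) := by
  have h₀ : 0 < n := zero_lt_one.trans h₁
  have h : runningTotal A 0 = 0 := by simp [runningTotal]
  rw [runningTotal_succ A h₁, runningTotal_succ A h₀, h, prefixMean_one A h₀]
  simp [sqDist]

theorem runningTotal_two_pos (A : Fin n → Pt d) (h₀ : 0 < n) (h₁ : 1 < n)
    (hA : A ⟨0, h₀⟩ ≠ A ⟨1, h₁⟩) : 0 < runningTotal A 2 := by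
  rw [runningTotal_two A h₁, sqDist]
  refine pow_pos (norm_pos_iff.2 ?_) 2
  have h1 : prefixMean A 2 = (2 : ℝ)⁻¹ • (A ⟨0, h₀⟩ + A ⟨1, h₁⟩) := by
    rw [prefixMean_succ A h₁, prefixMean_one A h₀]
    norm_num
  rw [h1]
  intro h2
  apply hA
  have h3 := sub_eq_zero.1 h2
  have h4 : (2 : ℝ) • A ⟨1, h₁⟩ = A ⟨0, h₀⟩ + A ⟨1, h₁⟩ := by
    conv_lhs => rw [h3]
    rw [smul_smul]
    norm_num
  rw [two_smul] at h4
  exact (add_right_cancel h4).symm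

theorem runningTotal_mono (A : Fin n → Pt d) {m m' : ℕ} (h : m ≤ m') :
    runningTotal A m ≤ runningTotal A m' := by
  refine Finset.sum_le_sum_of_subset_of_nonneg (fun j hj => ?_) fun _ _ _ => sqDist_nonneg _ _
  simp only [Finset.mem_filter, Finset.mem_univ, true_and] at hj ⊢
  omega

theorem sub_div_le_log_sub_log {x y : ℝ} (hx : 0 < x) (hy : 0 < y) :
    (y - x) / y ≤ Real.log y - Real.log x := by
  rw [← Real.log_div hy.ne' hx.ne']
  have h := Real.one_sub_inv_le_log_of_pos (div_pos hy hx)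
  rwa [inv_div, ← div_self hy.ne', ← sub_div] at h

/-- Both parts of the sensitivity have the form `(y - x) / y ≤ log y - log x`, with consecutive
values of `S` and with `m - 1, m`, and telescope. The second point accounts for `10 = 2 + 8`, the
first for the summand `1`. -/
theorem sum_streamProb_le {r : ℝ} (hr : 0 < r) (A : Fin n → Pt d) (hS : 0 < runningTotal A 2)
    {m : ℕ} (hm2 : 2 ≤ m) (hmn : m ≤ n) :
    ∑ i : Fin n with i.val < m, streamProb r A i ≤
      1 + r * (10 + 2 * (Real.log (runningTotal A m) - Real.log (runningTotal A 2)) +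
        8 * Real.log ((m : ℝ) - 1)) := by
  induction m, hm2 using Nat.le_induction with
  | base =>
    have hn₁ : 1 < n := hmn
    have hn₀ : 0 < n := zero_lt_one.trans hn₁
    have h1 : streamProb r A ⟨1, hn₁⟩ ≤ r * 10 := by
      rw [streamProb, if_neg (by simp)]
      refine (min_le_right _ _).trans ?_
      have h2 : 2 * sqDist (prefixMean A (1 + 1)) (A ⟨1, hn₁⟩) / runningTotal A (1 + 1) ≤ 2 := by
        rw [div_le_iff₀ hS, ← runningTotal_two A hn₁]
      norm_num at h2 ⊢
      gcongr
      linarith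
    rw [sum_filter_lt_succ _ hn₁, sum_filter_lt_succ _ hn₀]
    have h3 := streamProb_le_one r A ⟨0, hn₀⟩
    norm_num
    linarith
  | succ m hm ih =>
    have hmpos : (2 : ℝ) ≤ m := by exact_mod_cast hm
    have hSm : 0 < runningTotal A m := hS.trans_le (runningTotal_mono A hm)
    have hSm' : 0 < runningTotal A (m + 1) := hS.trans_le (runningTotal_mono A (by omega))
    rw [sum_filter_lt_succ _ hmn]
    have h1 := ih (by omega)
    have h2 : streamProb r A ⟨m, hmn⟩ ≤ r * (2 * (Real.log (runningTotal A (m + 1)) -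
        Real.log (runningTotal A m)) + 8 * (Real.log m - Real.log ((m : ℝ) - 1))) := by
      rw [streamProb, if_neg (by simp; omega)]
      refine (min_le_right _ _).trans ?_
      gcongr
      · rw [mul_div_assoc]
        gcongr
        have h3 := sub_div_le_log_sub_log hSm hSm'
        rwa [runningTotal_succ A hmn, add_sub_cancel_left, ← runningTotal_succ A hmn] at h3
      · have h3 := sub_div_le_log_sub_log (x := (m : ℝ) - 1) (y := m) (by linarith) (by linarith)
        rw [sub_sub_cancel] at h3
        calc (8 : ℝ) / m = 8 * (1 / m) := by ring
          _ ≤ _ := by gcongr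
    have h4 : ((m + 1 : ℕ) : ℝ) - 1 = m := by push_cast; ring
    rw [h4]
    linarith

theorem integral_length_coresetOf_le {r c D D₀ : ℝ} (hc : 0 < c) (hD₀ : 0 < D₀) (hD : D₀ ≤ D)
    (hr : r = c * D) (A : Fin n → Pt d) (h₀ : 0 < n) (hn : 1 < n)
    (hA : A ⟨0, h₀⟩ ≠ A ⟨1, hn⟩) :
    ∫ u : Fin n → unitInterval, ((coresetOf r A u).length : ℝ) ≤
      (23 * c + 2 / D₀) * (D * (Real.log n + Real.log (meanCost A) -
        Real.log (sqDist (prefixMean A 2) (A ⟨1, hn⟩)))) := by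
  have hD0 : 0 < D := hD₀.trans_le hD
  have hr0 : 0 < r := by rw [hr]; positivity
  have hS := runningTotal_two_pos A h₀ hn hA
  rw [integral_length_coresetOf hr0, ← runningTotal_two A hn, ← sum_filter_lt_self]
  have h1 := sum_streamProb_le hr0 A hS hn le_rfl
  have hn' : (2 : ℝ) ≤ n := by exact_mod_cast hn
  have h2 : Real.log (runningTotal A n) ≤ Real.log (meanCost A) :=
    Real.log_le_log (hS.trans_le (runningTotal_mono A hn)) (runningTotal_le_meanCost A le_rfl)
  have h3 : Real.log (runningTotal A 2) ≤ Real.log (meanCost A) :=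
    Real.log_le_log hS (runningTotal_le_meanCost A hn)
  have h4 : Real.log ((n : ℝ) - 1) ≤ Real.log n := Real.log_le_log (by linarith) (by linarith)
  have h5 : Real.log 2 ≤ Real.log n := Real.log_le_log (by norm_num) hn'
  have h6 := Real.log_two_gt_d9
  obtain ⟨Λ, hΛ⟩ : ∃ Λ, Λ = Real.log n + Real.log (meanCost A) - Real.log (runningTotal A 2) :=
    ⟨_, rfl⟩
  rw [← hΛ]
  have hΛ0 : 1 ≤ 2 * Λ := by linarith
  -- The logarithms are at most `8 Λ`, and `10 ≤ 15 Λ` because `Λ ≥ log 2`.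
  have h7 : r * (10 + 2 * (Real.log (runningTotal A n) - Real.log (runningTotal A 2)) +
      8 * Real.log ((n : ℝ) - 1)) ≤ r * (23 * Λ) := by
    gcongr
    linarith
  -- Absorbs the first point, which is always kept.
  have h8 : 1 ≤ 2 / D₀ * (D * Λ) := by
    rw [div_mul_eq_mul_div, le_div_iff₀ hD₀]
    nlinarith
  calc _ ≤ _ := h1
    _ ≤ 2 / D₀ * (D * Λ) + r * (23 * Λ) := by linarith
    _ = _ := by rw [hr]; ring

end Size

/-! ### The choice of the constant -/

section Constants

theorem log_net_le {ε : ℝ} (hε : 0 < ε) (hε1 : ε < 1) {d k : ℕ} (hd : 1 ≤ d) {e : ℝ}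
    (he : e = ε / 110) :
    (Real.exp 1 * (5 / e * (1 + 18 / e ^ 3) ^ d)) ^ k ≤
      Real.exp (d * k * (100 + 4 * Real.log (1 / ε))) := by
  have he0 : 0 < e := by rw [he]; positivity
  have he1 : e ≤ 1 := by rw [he]; linarith
  have hexp1 : Real.exp 1 ≤ 3 := by linarith [Real.exp_one_lt_d9]
  have hQ : 1 + 18 / e ^ 3 ≤ 19 / e ^ 3 := by
    have : 1 ≤ 1 / e ^ 3 := by rw [le_div_iff₀ (by positivity), one_mul]; exact pow_le_one₀ he0.le he1
    have h2 : 19 / e ^ 3 = 1 / e ^ 3 + 18 / e ^ 3 := by ring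
    linarith
  have h15 : 1 ≤ 15 / e := by rw [le_div_iff₀ he0]; linarith
  have hbase : Real.exp 1 * (5 / e * (1 + 18 / e ^ 3) ^ d) ≤ (15 / e * (19 / e ^ 3)) ^ d := by
    calc _ ≤ 3 * (5 / e * (19 / e ^ 3) ^ d) := by gcongr
      _ = 15 / e * (19 / e ^ 3) ^ d := by ring
      _ ≤ (15 / e) ^ d * (19 / e ^ 3) ^ d := by
          gcongr
          exact le_self_pow₀ h15 (by omega)
      _ = _ := by rw [mul_pow]
  have hle : 15 / e * (19 / e ^ 3) ≤ Real.exp (100 + 4 * Real.log (1 / ε)) := by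
    have h1 : Real.exp (4 * Real.log (1 / ε)) = (1 / ε) ^ 4 := by
      rw [show (4 : ℝ) * Real.log (1 / ε) = ((4 : ℕ) : ℝ) * Real.log (1 / ε) by norm_num,
        Real.exp_nat_mul, Real.exp_log (by positivity)]
    have h2 : (285 * 110 ^ 4 : ℝ) ≤ Real.exp 100 := by
      calc (285 * 110 ^ 4 : ℝ) ≤ 2 ^ 100 := by norm_num
        _ ≤ Real.exp 1 ^ 100 := by
            gcongr
            linarith [Real.exp_one_gt_d9]
        _ = _ := by rw [← Real.exp_nat_mul]; norm_num
    rw [Real.exp_add, h1, he]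
    calc _ = (285 * 110 ^ 4 : ℝ) * (1 / ε) ^ 4 := by field_simp; norm_num
      _ ≤ _ := by gcongr
  calc _ ≤ ((15 / e * (19 / e ^ 3)) ^ d) ^ k := by gcongr
    _ ≤ (Real.exp (100 + 4 * Real.log (1 / ε)) ^ d) ^ k := by gcongr
    _ = _ := by
        rw [← pow_mul, ← Real.exp_nat_mul]
        push_cast
        rfl

/-- The accuracy guarantee for `r = c d k log (1 / ε) / ε²`. -/
theorem accuracy {ε₀ : ℝ} (hε₀ : 0 < ε₀) (hε₀1 : ε₀ < 1) {c : ℝ}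
    (hc : c = 10 ^ 9 * (1 + 1 / Real.log (1 / ε₀))) {n d k : ℕ} {ε : ℝ} (A : Fin n → Pt d)
    (hd : 1 ≤ d) (hk : 1 ≤ k) (hε : 0 < ε) (hεε : ε ≤ ε₀) :
    0.99 ≤ (volume : Measure (Fin n → unitInterval)).real
      {u | IsAdditiveCoreset k ε A (coresetOf (c * (d * k * Real.log (1 / ε) / ε ^ 2)) A u)} := by
  have hε1 : ε < 1 := by linarith
  have hl₀ : 0 < Real.log (1 / ε₀) := Real.log_pos (by rw [lt_div_iff₀ hε₀]; linarith)
  obtain ⟨l, hl⟩ : ∃ l, l = Real.log (1 / ε) := ⟨_, rfl⟩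
  have hll : Real.log (1 / ε₀) ≤ l := by
    rw [hl]
    exact Real.log_le_log (by positivity) (one_div_le_one_div_of_le hε hεε)
  have hl0 : 0 < l := hl₀.trans_le hll
  have hd' : (1 : ℝ) ≤ d := by exact_mod_cast hd
  have hk' : (1 : ℝ) ≤ k := by exact_mod_cast hk
  have hdk : (1 : ℝ) ≤ d * k := one_le_mul_of_one_le_of_one_le hd' hk'
  have hkdk : (k : ℝ) ≤ d * k := le_mul_of_one_le_left (by linarith) hd'
  -- The summand `1 / log (1 / ε₀)` in `c` makes `c * l` dominate a constant even when `l` is small;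
  -- this is where `c` depends on `ε₀`.
  have hcl : 10 ^ 9 * (l + 1) ≤ c * l := by
    have h1 : 1 ≤ 1 / Real.log (1 / ε₀) * l := by
      rw [div_mul_eq_mul_div, le_div_iff₀ hl₀]; linarith
    rw [hc]
    linarith
  have hc0 : 0 < c := by rw [hc]; positivity
  rw [← hl]
  obtain ⟨r, hr⟩ : ∃ r, r = c * (d * k * l / ε ^ 2) := ⟨_, rfl⟩
  rw [← hr]
  have hr0 : 0 < r := by rw [hr]; positivity
  obtain ⟨e, he⟩ : ∃ e, e = ε / 110 := ⟨_, rfl⟩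
  have he0 : 0 < e := by rw [he]; positivity
  have he1 : e ≤ 1 / 2 := by rw [he]; linarith
  have hre : r * e ^ 2 = d * k * (c * l) / 12100 := by
    rw [hr, he]; field_simp; norm_num
  have h110 : 110 * e = ε := by rw [he]; ring
  have hdkcl : d * k * (10 ^ 9 * (l + 1)) ≤ d * k * (c * l) := by gcongr
  have hdkl : 0 ≤ d * k * l := by positivity
  have key := (isSensitivitySampling_streamProb hk hr0 A).le_measureReal hk he0 he1
    (by rw [hre, le_div_iff₀ (by norm_num)]; linarith) ?_
  · refine key.trans (measureReal_mono fun u hu X => ?_)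
    have := hu X
    rwa [weightedCost_sub_cost, ← h110]
  · have hnet := log_net_le (k := k) hε hε1 hd he
    rw [← hl] at hnet
    calc _ ≤ Real.exp (d * k * (100 + 4 * l)) * (2 * Real.exp (-(r * e ^ 2 / 4))) := by gcongr
      _ = 2 * Real.exp (d * k * (100 + 4 * l) - r * e ^ 2 / 4) := by
          rw [sub_eq_add_neg, Real.exp_add]; ring
      _ ≤ 2 * Real.exp (-1000) := by
          gcongr
          rw [hre]
          linarith
      _ ≤ 1 / 500 := by
          have h1 := Real.add_one_le_exp (1000 : ℝ)
          rw [Real.exp_neg]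
          have h2 : (Real.exp 1000)⁻¹ ≤ (1000 : ℝ)⁻¹ := by
            apply inv_anti₀ (by norm_num)
            linarith
          norm_num at h2 ⊢
          linarith

end Constants

/-! ### Reasoning about programs -/

section Programs

variable {d B : ℕ} {p : Pt d} {u : ℝ}

/-- The program `c`, started in `s`, halts in a configuration and after a number of steps that
satisfy `Q`. -/
def Runs (B : ℕ) (p : Pt d) (u : ℝ) (c : Prog) (s : Config) (Q : Config → ℕ → Prop) : Prop :=
  ∃ s' t, Exec B p u c s s' t ∧ Q s' t

theorem Runs.mono {c : Prog} {s : Config} {Q Q' : Config → ℕ → Prop} (h : Runs B p u c s Q)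
    (hQ : ∀ s' t, Q s' t → Q' s' t) : Runs B p u c s Q' :=
  let ⟨s', t, he, hq⟩ := h
  ⟨s', t, he, hQ s' t hq⟩

theorem Runs.const {dst : Addr} {q : ℕ} {s : Config} {Q : Config → ℕ → Prop}
    (h : dst.cell s < B) (hQ : Q (s.set dst q) 1) : Runs B p u (.const dst q) s Q :=
  ⟨_, _, .const h, hQ⟩

theorem Runs.arith {o : Op} {dst a b : Addr} {s : Config} {Q : Config → ℕ → Prop}
    (h : dst.cell s < B) (ha : a.cell s < B) (hb : b.cell s < B)
    (hdiv : o = .div → s.get b ≠ 0) (hQ : Q (s.set dst (o.eval (s.get a) (s.get b))) 1) :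
    Runs B p u (.arith o dst a b) s Q :=
  ⟨_, _, .arith h ha hb hdiv, hQ⟩

theorem Runs.input {dst : Addr} {x : ℕ} {s : Config} {Q : Config → ℕ → Prop}
    (h : dst.cell s < B) (hx : s.idx x < d) (hQ : Q (s.set dst (p ⟨s.idx x, hx⟩)) 1) :
    Runs B p u (.input dst x) s Q :=
  ⟨_, _, .input h hx, hQ⟩

theorem Runs.rand {dst : Addr} {s : Config} {Q : Config → ℕ → Prop}
    (h : dst.cell s < B) (hQ : Q (s.set dst u) 1) : Runs B p u (.rand dst) s Q :=
  ⟨_, _, .rand h, hQ⟩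

theorem Runs.emit {a : Addr} {s : Config} {Q : Config → ℕ → Prop}
    (h : a.cell s < B) (hQ : Q { s with out := s.out ++ [s.get a] } 1) :
    Runs B p u (.emit a) s Q :=
  ⟨_, _, .emit h, hQ⟩

theorem Runs.idxZero {x : ℕ} {s : Config} {Q : Config → ℕ → Prop} (hQ : Q (s.setIdx x 0) 1) :
    Runs B p u (.idxZero x) s Q :=
  ⟨_, _, .idxZero, hQ⟩

theorem Runs.idxSucc {x : ℕ} {s : Config} {Q : Config → ℕ → Prop}
    (hQ : Q (s.setIdx x (s.idx x + 1)) 1) : Runs B p u (.idxSucc x) s Q :=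
  ⟨_, _, .idxSucc, hQ⟩

/-- The second program is a goal nested in the postcondition of the first, so a program is verified
by reading its text in order while step counts accumulate. -/
theorem Runs.seq {c₁ c₂ : Prog} {s : Config} {Q : Config → ℕ → Prop}
    (h : Runs B p u c₁ s fun s₁ t₁ => Runs B p u c₂ s₁ fun s₂ t₂ => Q s₂ (t₁ + t₂)) :
    Runs B p u (.seq c₁ c₂) s Q :=
  let ⟨_, _, h₁, _, _, h₂, hQ⟩ := h
  ⟨_, _, .seq h₁ h₂, hQ⟩

theorem Runs.ifLe {a b : Addr} {c₁ c₂ : Prog} {s : Config} {Q : Config → ℕ → Prop}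
    (ha : a.cell s < B) (hb : b.cell s < B)
    (h₁ : s.get a ≤ s.get b → Runs B p u c₁ s fun s' t => Q s' (t + 1))
    (h₂ : ¬ s.get a ≤ s.get b → Runs B p u c₂ s fun s' t => Q s' (t + 1)) :
    Runs B p u (.ifLe a b c₁ c₂) s Q := by
  by_cases hab : s.get a ≤ s.get b
  · obtain ⟨s', t, he, hQ⟩ := h₁ hab
    exact ⟨s', t + 1, .ifTrue ha hb hab he, hQ⟩
  · obtain ⟨s', t, he, hQ⟩ := h₂ hab
    exact ⟨s', t + 1, .ifFalse ha hb hab he, hQ⟩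

theorem Runs.whileLtDim {x T : ℕ} {c : Prog} {s : Config} {Q : Config → ℕ → Prop}
    (I : ℕ → Config → Prop) (hidx : ∀ j s, I j s → s.idx x = j)
    (hbody : ∀ j s, j < d → I j s → Runs B p u c s fun s' t => I (j + 1) s' ∧ t ≤ T)
    (h₀ : I 0 s) (hQ : ∀ s' t, I d s' → t ≤ d * (T + 1) + 1 → Q s' t) :
    Runs B p u (.whileLtDim x c) s Q := by
  have key : ∀ m j s, j + m = d → I j s → ∃ s' t, Exec B p u (.whileLtDim x c) s s' t ∧ I d s' ∧
      t ≤ m * (T + 1) + 1 := by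
    intro m
    induction m with
    | zero =>
      intro j s hj hI
      obtain rfl : j = d := by omega
      exact ⟨s, 1, .whileStop (by rw [hidx _ _ hI]; omega), hI, by omega⟩
    | succ m ih =>
      intro j s hj hI
      obtain ⟨s₁, t₁, he₁, hI₁, ht₁⟩ := hbody j s (by omega) hI
      obtain ⟨s₂, t₂, he₂, hI₂, ht₂⟩ := ih (j + 1) s₁ (by omega) hI₁
      refine ⟨s₂, _, .whileStep (by rw [hidx _ _ hI]; omega) he₁ he₂, hI₂, ?_⟩
      rw [Nat.succ_mul]
      omega
  obtain ⟨s', t, he, hI, ht⟩ := key d 0 s (by omega) h₀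
  exact ⟨s', t, he, hQ s' t hI ht⟩

end Programs

/-! ### A program for the algorithm

Cell `0` holds `r`, cell `1` the number of earlier points, cell `2` the sum `S`, and the cells from
`10` on hold the mean; the other cells below `10` are for temporary values. -/

section Implementation

/-- Update of one coordinate of the mean, and of the squared distance in cell `4`. -/
def meanBody : Prog :=
  .seq (.input (.direct 5) 0) <|
  .seq (.arith .mul (.indexed 10 0) (.direct 1) (.indexed 10 0)) <|
  .seq (.arith .add (.indexed 10 0) (.indexed 10 0) (.direct 5)) <|
  .seq (.arith .div (.indexed 10 0) (.indexed 10 0) (.direct 3)) <|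
  .seq (.arith .sub (.direct 5) (.direct 5) (.indexed 10 0)) <|
  .seq (.arith .mul (.direct 5) (.direct 5) (.direct 5)) <|
  .seq (.arith .add (.direct 4) (.direct 4) (.direct 5)) <|
  .idxSucc 0

/-- Update of the count in cell `3`, the mean and the sum. -/
def updateProg : Prog :=
  .seq (.const (.direct 8) 1) <|
  .seq (.arith .add (.direct 3) (.direct 1) (.direct 8)) <|
  .seq (.const (.direct 4) 0) <|
  .seq (.idxZero 0) <|
  .seq (.whileLtDim 0 meanBody) <|
  .arith .add (.direct 2) (.direct 2) (.direct 4)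

/-- The sampling probability, in cell `7`. -/
def probProg : Prog :=
  .seq (.const (.direct 6) 0) <|
  .ifLe (.direct 1) (.direct 6) (.const (.direct 7) 1) <|
  .seq (.ifLe (.direct 2) (.direct 6) (.const (.direct 5) 0) <|
    .seq (.arith .add (.direct 5) (.direct 4) (.direct 4)) <|
    .arith .div (.direct 5) (.direct 5) (.direct 2)) <|
  .seq (.const (.direct 7) 8) <|
  .seq (.arith .div (.direct 7) (.direct 7) (.direct 1)) <|
  .seq (.arith .add (.direct 5) (.direct 5) (.direct 7)) <|
  .seq (.arith .mul (.direct 5) (.direct 0) (.direct 5)) <|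
  .ifLe (.direct 5) (.direct 8) (.arith .add (.direct 7) (.direct 5) (.direct 6)) <|
  .const (.direct 7) 1

/-- Output of the current point with its weight. -/
def emitProg : Prog :=
  .seq (.idxZero 0) <|
  .seq (.whileLtDim 0 <|
    .seq (.input (.direct 5) 0) <| .seq (.emit (.direct 5)) <| .idxSucc 0) <|
  .seq (.arith .div (.direct 5) (.direct 8) (.direct 7)) <|
  .emit (.direct 5)

/-- The program run at each arrival. -/
def filterProg : Prog :=
  .seq updateProg <|
  .seq probProg <|
  .seq (.arith .add (.direct 1) (.direct 3) (.direct 6)) <|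
  .seq (.rand (.direct 9)) <|
  .ifLe (.direct 9) (.direct 7) emitProg (.const (.direct 6) 0)

variable {d : ℕ} {u : ℝ}

/-- The configuration `s` represents the state `st`. -/
structure Represents (r : ℝ) (st : FilterState d) (s : Config) : Prop where
  param : s.mem 0 = r
  count : s.mem 1 = st.count
  total : s.mem 2 = st.total
  mean : ∀ j : Fin d, s.mem (10 + j) = st.mean j
  out : s.out = encode st.coreset

/-- The configuration after `j` rounds of the loop that updates the mean. -/
structure MeanInvariant (r : ℝ) (st : FilterState d) (p : Pt d) (j : ℕ) (s : Config) : Prop where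
  idx : s.idx 0 = j
  param : s.mem 0 = r
  count : s.mem 1 = st.count
  total : s.mem 2 = st.total
  newCount : s.mem 3 = st.count + 1
  dist : s.mem 4 = ∑ l : Fin d with l.val < j, (p l - newMean st p l) ^ 2
  one : s.mem 8 = 1
  mean : ∀ l : Fin d, s.mem (10 + l) = if l.val < j then newMean st p l else st.mean l
  out : s.out = encode st.coreset

theorem newMean_apply (st : FilterState d) (p : Pt d) (l : Fin d) :
    newMean st p l = (st.count * st.mean l + p l) / (st.count + 1) := by
  simp only [newMean, PiLp.smul_apply, PiLp.add_apply, smul_eq_mul]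
  ring

theorem sqDist_eq_sum (x a : Pt d) : sqDist x a = ∑ l, (a l - x l) ^ 2 := by
  simp [sqDist, EuclideanSpace.real_norm_sq_eq]

/-- The mean and the squared distance are computed coordinatewise, so one pass can overwrite the old
mean and needs only one temporary cell. -/
theorem runs_meanBody {B : ℕ} {r : ℝ} {st : FilterState d} {p : Pt d} {j : ℕ} {s : Config}
    (hB : 10 + d ≤ B) (hj : j < d) (h : MeanInvariant r st p j s) :
    Runs B p u meanBody s fun s' t => MeanInvariant r st p (j + 1) s' ∧ t ≤ 8 := by
  have hidx := h.idx
  have hne : ∀ b, b < 10 → ¬ (b = 10 + j) := by intros; omega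
  have hne' : ∀ b, b < 10 → ¬ (10 + j = b) := by intros; omega
  have hcnt : (st.count : ℝ) + 1 ≠ 0 := by positivity
  have hm := h.mean ⟨j, hj⟩
  simp only [lt_irrefl, if_false] at hm
  refine .seq (.input (by simp [Addr.cell]; omega) (by omega) ?_)
  refine .seq (.arith (by simp [Addr.cell, Config.set, hidx]; omega) (by simp [Addr.cell]; omega)
    (by simp [Addr.cell, Config.set, hidx]; omega) (by simp) ?_)
  refine .seq (.arith (by simp [Addr.cell, Config.set, hidx]; omega)
    (by simp [Addr.cell, Config.set, hidx]; omega) (by simp [Addr.cell]; omega) (by simp) ?_)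
  refine .seq (.arith (by simp [Addr.cell, Config.set, hidx]; omega)
    (by simp [Addr.cell, Config.set, hidx]; omega) (by simp [Addr.cell]; omega)
    (fun _ => by
      simp [Config.get, Config.set, Addr.cell, Function.update, hidx, h.newCount, hne, hcnt]) ?_)
  refine .seq (.arith (by simp [Addr.cell]; omega) (by simp [Addr.cell]; omega)
    (by simp [Addr.cell, Config.set, hidx]; omega) (by simp) ?_)
  refine .seq (.arith (by simp [Addr.cell]; omega) (by simp [Addr.cell]; omega)
    (by simp [Addr.cell]; omega) (by simp) ?_)
  refine .seq (.arith (by simp [Addr.cell]; omega) (by simp [Addr.cell]; omega)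
    (by simp [Addr.cell]; omega) (by simp) ?_)
  refine .idxSucc ⟨?_, by norm_num⟩
  have hnm := newMean_apply st p ⟨j, hj⟩
  have hd := h.dist
  have hd' := sum_filter_lt_succ (fun l : Fin d => (p l - newMean st p l) ^ 2) hj
  constructor
  · simp [Config.set, Config.setIdx, hidx]
  · simp [Config.get, Config.set, Config.setIdx, Addr.cell, Function.update, hidx, hne, h.param]
  · simp [Config.get, Config.set, Config.setIdx, Addr.cell, Function.update, hidx, hne, h.count]
  · simp [Config.get, Config.set, Config.setIdx, Addr.cell, Function.update, hidx, hne, h.total]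
  · simp [Config.get, Config.set, Config.setIdx, Addr.cell, Function.update, hidx, hne, h.newCount]
  · rw [hd', hnm]
    simp [Config.get, Config.set, Config.setIdx, Addr.cell, Function.update, hidx, hne, hne',
      Op.eval, h.newCount, h.count, hm, hd]
    ring
  · simp [Config.get, Config.set, Config.setIdx, Addr.cell, Function.update, hidx, hne, h.one]
  · intro l
    have hml := h.mean l
    by_cases hlj : l.val = j
    · have hl : l = ⟨j, hj⟩ := Fin.ext hlj
      subst hl
      rw [if_pos (by simp), hnm]
      simp [Config.get, Config.set, Config.setIdx, Addr.cell, Function.update, hidx, hne, hne',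
        Op.eval, h.newCount, h.count, hm]
    · have hl1 : ∀ b, b < 10 → ¬ (10 + l.val = b) := by intros; omega
      have hl2 : (l.val < j + 1) ↔ (l.val < j) := by omega
      simp only [hl2, ← hml]
      simp [Config.get, Config.set, Config.setIdx, Addr.cell, Function.update, hidx, hl1, hlj]
  · simp [Config.set, Config.setIdx, h.out]

/-- The configuration `s` after the update for the point `p`, in the state `st`. -/
structure Updated (r : ℝ) (st : FilterState d) (p : Pt d) (s : Config) : Prop where
  param : s.mem 0 = r
  count : s.mem 1 = st.count
  total : s.mem 2 = newTotal st p
  newCount : s.mem 3 = st.count + 1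
  dist : s.mem 4 = sqDist (newMean st p) p
  one : s.mem 8 = 1
  mean : ∀ l : Fin d, s.mem (10 + l) = newMean st p l
  out : s.out = encode st.coreset

theorem Updated.set {r : ℝ} {st : FilterState d} {p : Pt d} {s : Config}
    (h : Updated r st p s) {b : ℕ} (hb : b = 5 ∨ b = 6 ∨ b = 7) (v : ℝ) :
    Updated r st p (s.set (.direct b) v) := by
  have hne : ∀ c, c ≠ 5 → c ≠ 6 → c ≠ 7 → c ≠ b := by intros; omega
  constructor <;> simp only [Config.set, Addr.cell]
  · rw [Function.update_of_ne (hne _ (by simp) (by simp) (by simp)), h.param]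
  · rw [Function.update_of_ne (hne _ (by simp) (by simp) (by simp)), h.count]
  · rw [Function.update_of_ne (hne _ (by simp) (by simp) (by simp)), h.total]
  · rw [Function.update_of_ne (hne _ (by simp) (by simp) (by simp)), h.newCount]
  · rw [Function.update_of_ne (hne _ (by simp) (by simp) (by simp)), h.dist]
  · rw [Function.update_of_ne (hne _ (by simp) (by simp) (by simp)), h.one]
  · intro l
    rw [Function.update_of_ne (hne _ (by omega) (by omega) (by omega)), h.mean]
  · exact h.out

theorem runs_updateProg {B : ℕ} {r : ℝ} {st : FilterState d} {p : Pt d} {s : Config}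
    (hB : 10 + d ≤ B) (h : Represents r st s) :
    Runs B p u updateProg s fun s' t => Updated r st p s' ∧ t ≤ 9 * d + 6 := by
  refine .seq (.const (by simp [Addr.cell]; omega) ?_)
  refine .seq (.arith (by simp [Addr.cell]; omega) (by simp [Addr.cell]; omega)
    (by simp [Addr.cell]; omega) (by simp) ?_)
  refine .seq (.const (by simp [Addr.cell]; omega) ?_)
  refine .seq (.idxZero ?_)
  refine .seq (.whileLtDim (MeanInvariant r st p) (fun _ _ h => h.idx)
    (fun j s hj hI => runs_meanBody hB hj hI) ?_ ?_)
  · constructor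
    · simp [Config.setIdx]
    · simp [Config.get, Config.set, Config.setIdx, Addr.cell, Function.update, h.param]
    · simp [Config.get, Config.set, Config.setIdx, Addr.cell, Function.update, h.count]
    · simp [Config.get, Config.set, Config.setIdx, Addr.cell, Function.update, h.total]
    · simp [Config.get, Config.set, Config.setIdx, Addr.cell, Function.update, Op.eval, h.count]
    · simp [Config.get, Config.set, Config.setIdx, Addr.cell, Function.update]
    · simp [Config.get, Config.set, Config.setIdx, Addr.cell, Function.update]
    · intro l
      have hl1 : ∀ b, b < 10 → ¬ (10 + l.val = b) := by intros; omega
      simp [Config.get, Config.set, Config.setIdx, Addr.cell, Function.update, hl1, h.mean]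
    · simp [Config.set, Config.setIdx, h.out]
  · intro s' t hI ht
    refine .arith (by simp [Addr.cell]; omega) (by simp [Addr.cell]; omega)
      (by simp [Addr.cell]; omega) (by simp) ⟨?_, by omega⟩
    have hdist := hI.dist
    rw [sum_filter_lt_self, ← sqDist_eq_sum] at hdist
    constructor
    · simp [Config.get, Config.set, Addr.cell, Function.update, hI.param]
    · simp [Config.get, Config.set, Addr.cell, Function.update, hI.count]
    · simp [Config.get, Config.set, Addr.cell, Function.update, Op.eval, hI.total, hdist, newTotal]
    · simp [Config.get, Config.set, Addr.cell, Function.update, hI.newCount]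
    · simp [Config.get, Config.set, Addr.cell, Function.update, hdist]
    · simp [Config.get, Config.set, Addr.cell, Function.update, hI.one]
    · intro l
      have hl1 : ∀ b, b < 10 → ¬ (10 + l.val = b) := by intros; omega
      simp [Config.get, Config.set, Addr.cell, Function.update, hl1, hI.mean]
    · simp [Config.set, hI.out]

theorem runs_probProg {B : ℕ} {r : ℝ} {st : FilterState d} {p : Pt d} {s : Config}
    (hB : 10 + d ≤ B) (h : Updated r st p s) (hS : 0 ≤ newTotal st p) :
    Runs B p u probProg s fun s' t =>
      (Updated r st p s' ∧ s'.mem 6 = 0 ∧ s'.mem 7 = sampleProb r st p) ∧ t ≤ 12 := by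
  refine .seq (.const (by simp [Addr.cell]; omega) ?_)
  have h' := h.set (b := 6) (by simp) ((0 : ℕ) : ℝ)
  have h6 : (s.set (.direct 6) ((0 : ℕ) : ℝ)).mem 6 = 0 := by simp [Config.set, Addr.cell]
  generalize s.set (.direct 6) ((0 : ℕ) : ℝ) = s₁ at h' h6
  clear h
  refine .ifLe (by simp [Addr.cell]; omega) (by simp [Addr.cell]; omega) (fun hle => ?_)
    (fun hle => ?_)
  · refine .const (by simp [Addr.cell]; omega) ⟨⟨h'.set (by simp) _, ?_, ?_⟩, by norm_num⟩
    · simp [Config.set, Addr.cell, Function.update, h6]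
    · simp only [Config.get, Addr.cell, h'.count, h6] at hle
      have h0 : st.count = 0 := by
        have : (st.count : ℝ) = 0 := le_antisymm hle (Nat.cast_nonneg _)
        exact_mod_cast this
      simp [Config.set, Addr.cell, sampleProb, h0]
  · simp only [Config.get, Addr.cell, h'.count, h6, not_le] at hle
    have hc0 : st.count ≠ 0 := by
      rintro h0
      rw [h0] at hle
      simp at hle
    have hfirst : Runs B p u (.ifLe (.direct 2) (.direct 6) (.const (.direct 5) 0) <|
        .seq (.arith .add (.direct 5) (.direct 4) (.direct 4)) <|
        .arith .div (.direct 5) (.direct 5) (.direct 2)) s₁ fun s' t => (Updated r st p s' ∧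
          s'.mem 6 = 0 ∧ s'.mem 5 = 2 * sqDist (newMean st p) p / newTotal st p) ∧ t ≤ 3 := by
      refine .ifLe (by simp [Addr.cell]; omega) (by simp [Addr.cell]; omega) (fun hle => ?_)
        (fun hle => ?_)
      · refine .const (by simp [Addr.cell]; omega) ⟨⟨h'.set (by simp) _, ?_, ?_⟩, by norm_num⟩
        · simp [Config.set, Addr.cell, Function.update, h6]
        · simp only [Config.get, Addr.cell, h'.total, h6] at hle
          -- The program avoids the division and stores `0`, which is also the value of a quotient
          -- by zero in `sampleProb`.
          have h0 : newTotal st p = 0 := le_antisymm hle hS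
          simp [Config.set, Addr.cell, h0]
      · simp only [Config.get, Addr.cell, h'.total, h6] at hle
        refine .seq (.arith (by simp [Addr.cell]; omega) (by simp [Addr.cell]; omega)
          (by simp [Addr.cell]; omega) (by simp) ?_)
        refine .arith (by simp [Addr.cell]; omega) (by simp [Addr.cell]; omega)
          (by simp [Addr.cell]; omega) (fun _ => ?_)
          ⟨⟨(h'.set (by simp) _).set (by simp) _, ?_, ?_⟩, by norm_num⟩
        · simp [Config.get, Config.set, Addr.cell, Function.update, h'.total]
          intro h0
          exact hle h0.le
        · simp [Config.set, Addr.cell, Function.update, h6]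
        · simp [Config.get, Config.set, Addr.cell, Function.update, Op.eval, h'.total, h'.dist,
            two_mul]
    refine .seq (hfirst.mono ?_)
    rintro s₂ t₂ ⟨⟨hU, h26, h25⟩, ht₂⟩
    refine .seq (.const (by simp [Addr.cell]; omega) ?_)
    refine .seq (.arith (by simp [Addr.cell]; omega) (by simp [Addr.cell]; omega)
      (by simp [Addr.cell]; omega) (fun _ => ?_) ?_)
    · simp [Config.get, Config.set, Addr.cell, Function.update, hU.count, hc0]
    refine .seq (.arith (by simp [Addr.cell]; omega) (by simp [Addr.cell]; omega)
      (by simp [Addr.cell]; omega) (by simp) ?_)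
    refine .seq (.arith (by simp [Addr.cell]; omega) (by simp [Addr.cell]; omega)
      (by simp [Addr.cell]; omega) (by simp) ?_)
    refine .ifLe (by simp [Addr.cell]; omega) (by simp [Addr.cell]; omega) (fun hle => ?_)
      (fun hle => ?_)
    · simp [Config.get, Config.set, Addr.cell, Function.update, Op.eval, hU.one, hU.param, hU.count,
        h25] at hle
      refine .arith (by simp [Addr.cell]; omega) (by simp [Addr.cell]; omega)
        (by simp [Addr.cell]; omega) (by simp) ⟨⟨((((hU.set (by simp) _).set (by simp) _).set
          (by simp) _).set (by simp) _).set (by simp) _, ?_, ?_⟩, by omega⟩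
      · simp [Config.set, Addr.cell, Function.update, h26]
      · rw [sampleProb, if_neg hc0, min_eq_right hle]
        simp [Config.get, Config.set, Addr.cell, Function.update, Op.eval, hU.param, hU.count,
          h25, h26]
    · simp [Config.get, Config.set, Addr.cell, Function.update, Op.eval, hU.one, hU.param, hU.count,
        h25] at hle
      refine .const (by simp [Addr.cell]; omega) ⟨⟨((((hU.set (by simp) _).set (by simp) _).set
          (by simp) _).set (by simp) _).set (by simp) _, ?_, ?_⟩, by omega⟩
      · simp [Config.set, Addr.cell, Function.update, h26]
      · rw [sampleProb, if_neg hc0, min_eq_left hle.le]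
        simp [Config.set, Addr.cell]

theorem runs_emitProg {B : ℕ} {p : Pt d} {s : Config} (hB : 10 + d ≤ B) (h7 : s.mem 7 ≠ 0)
    (h8 : s.mem 8 = 1) :
    Runs B p u emitProg s fun s' t => ((∀ b, b ≠ 5 → s'.mem b = s.mem b) ∧
      s'.out = s.out ++ ((List.ofFn fun j => p j) ++ [1 / s.mem 7])) ∧ t ≤ 4 * d + 4 := by
  refine .seq (.idxZero ?_)
  refine .seq (.whileLtDim (T := 3) (fun j s' => s'.idx 0 = j ∧ (∀ b, b ≠ 5 → s'.mem b = s.mem b) ∧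
    s'.out = s.out ++ (List.ofFn fun j => p j).take j) (fun _ _ h => h.1) ?_ ?_ ?_)
  · rintro j s' hj ⟨h1, h2, h3⟩
    refine .seq (.input (by simp [Addr.cell]; omega) (by omega) ?_)
    refine .seq (.emit (by simp [Addr.cell]; omega) ?_)
    refine .idxSucc ⟨⟨?_, ?_, ?_⟩, by norm_num⟩
    · simp [Config.set, Config.setIdx, h1]
    · intro b hb
      simp [Config.set, Config.setIdx, Addr.cell, Function.update, hb, h2 b hb]
    · rw [List.take_succ_eq_append_getElem (by simpa using hj)]
      simp [Config.get, Config.set, Config.setIdx, Addr.cell, h3, h1]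
  · refine ⟨by simp [Config.setIdx], fun b _ => rfl, by simp [Config.setIdx]⟩
  · rintro s' t ⟨h1, h2, h3⟩ ht
    rw [List.take_of_length_le (by simp)] at h3
    have h27 := h2 7 (by norm_num)
    have h28 := h2 8 (by norm_num)
    refine .seq (.arith (by simp [Addr.cell]; omega) (by simp [Addr.cell]; omega)
      (by simp [Addr.cell]; omega) (fun _ => by simpa [Config.get, Addr.cell, h27] using h7) ?_)
    refine .emit (by simp [Addr.cell]; omega) ⟨⟨?_, ?_⟩, by omega⟩
    · intro b hb
      simp [Config.set, Addr.cell, Function.update, hb, h2 b hb]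
    · simp [Config.get, Config.set, Addr.cell, Op.eval, h3, h27, h28, h8]

theorem newTotal_nonneg {st : FilterState d} (hS : 0 ≤ st.total) (p : Pt d) :
    0 ≤ newTotal st p := add_nonneg hS (sqDist_nonneg _ _)

theorem sampleProb_pos {r : ℝ} (hr : 0 < r) {st : FilterState d} (hS : 0 ≤ st.total) (p : Pt d) :
    0 < sampleProb r st p := by
  unfold sampleProb
  split_ifs with h
  · exact zero_lt_one
  · have hc : (0 : ℝ) < st.count := by exact_mod_cast Nat.pos_of_ne_zero h
    have := div_nonneg (mul_nonneg zero_le_two (sqDist_nonneg (newMean st p) p))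
      (newTotal_nonneg hS p)
    exact lt_min zero_lt_one (by positivity)

/-- The count is copied by adding cell `6`, which holds zero; rewriting that zero serves as the
empty branch when the point is dropped. The step bound is `(9 d + 6) + 12 + 3 + (4 d + 4)`. -/
theorem runs_filterProg {B : ℕ} {r : ℝ} (hr : 0 < r) {st : FilterState d} {p : Pt d}
    {v : unitInterval} {s : Config} (hB : 10 + d ≤ B) (h : Represents r st s)
    (hS : 0 ≤ st.total) :
    Runs B p (v : ℝ) filterProg s fun s' t =>
      Represents r (filterStep r st (p, v)) s' ∧ t ≤ 13 * d + 25 := by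
  refine .seq ((runs_updateProg hB h).mono ?_)
  rintro s₁ t₁ ⟨h₁, ht₁⟩
  refine .seq ((runs_probProg hB h₁ (newTotal_nonneg hS p)).mono ?_)
  rintro s₂ t₂ ⟨⟨h₂, h26, h27⟩, ht₂⟩
  refine .seq (.arith (by simp [Addr.cell]; omega) (by simp [Addr.cell]; omega)
    (by simp [Addr.cell]; omega) (by simp) ?_)
  refine .seq (.rand (by simp [Addr.cell]; omega) ?_)
  have hl : ∀ (l : Fin d) b, b < 10 → ¬ (10 + l.val = b) := by intros; omega
  refine .ifLe (by simp [Addr.cell]; omega) (by simp [Addr.cell]; omega) (fun hle => ?_)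
    (fun hle => ?_)
  · have hp := sampleProb_pos hr hS p
    simp [Config.get, Config.set, Addr.cell, Function.update, h27] at hle
    refine (runs_emitProg hB ?_ ?_).mono ?_
    · simp [Config.set, Addr.cell, Function.update, h27, hp.ne']
    · simp [Config.set, Addr.cell, Function.update, h₂.one]
    · rintro s₃ t₃ ⟨⟨hmem, hout⟩, ht₃⟩
      refine ⟨?_, by omega⟩
      constructor
      · rw [hmem _ (by norm_num)]
        simp [Config.set, Addr.cell, Function.update, h₂.param]
      · rw [hmem _ (by norm_num)]
        simp [Config.get, Config.set, Addr.cell, Function.update, Op.eval, h₂.newCount, h26,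
          filterStep]
      · rw [hmem _ (by norm_num)]
        simp [Config.set, Addr.cell, Function.update, h₂.total, filterStep]
      · intro l
        rw [hmem _ (by omega)]
        simp [Config.set, Addr.cell, Function.update, hl, h₂.mean, filterStep]
      · rw [hout]
        simp [Config.set, Addr.cell, Function.update, h₂.out, filterStep, hle, encode, h27]
  · simp [Config.get, Config.set, Addr.cell, Function.update, h27] at hle
    refine .const (by simp [Addr.cell]; omega) ⟨?_, by omega⟩
    constructor
    · simp [Config.set, Addr.cell, Function.update, h₂.param]
    · simp [Config.get, Config.set, Addr.cell, Function.update, Op.eval, h₂.newCount, h26,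
        filterStep]
    · simp [Config.set, Addr.cell, Function.update, h₂.total, filterStep]
    · intro l
      simp [Config.set, Addr.cell, Function.update, hl, h₂.mean, filterStep]
    · simp [Config.set, h₂.out, filterStep, hle.not_ge]

theorem represents_start (r : ℝ) : Represents r (FilterState.init d) (Config.start r) where
  param := by simp [Config.start]
  count := by simp [Config.start, FilterState.init]
  total := by simp [Config.start, FilterState.init]
  mean l := by simp [Config.start, FilterState.init]
  out := by simp [Config.start, FilterState.init, encode]

theorem runsOnline_filterProg {B T : ℕ} (hB : 10 + d ≤ B) (hT : 13 * d + 25 ≤ T) {r : ℝ}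
    (hr : 0 < r) (l : List (Pt d × unitInterval)) :
    ∀ (st : FilterState d) (s : Config), Represents r st s → 0 ≤ st.total →
      ∃ s', RunsOnline B T filterProg s l s' ∧ Represents r (l.foldl (filterStep r) st) s' := by
  induction l with
  | nil => exact fun st s h _ => ⟨s, .nil, h⟩
  | cons x l ih =>
    obtain ⟨p, v⟩ := x
    intro st s h hS
    obtain ⟨s₁, t, he, h₁, ht⟩ := runs_filterProg (p := p) (v := v) hr hB h hS
    obtain ⟨s₂, hrun, h₂⟩ := ih _ s₁ h₁ (newTotal_nonneg hS p)
    exact ⟨s₂, .cons he (ht.trans hT) hrun, h₂⟩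

end Implementation

end KMeansFilter

/-! ### Accuracy, expected size, time and space together. -/

theorem corollary4p5 :
    -- accuracy and expected size, with `r = c d k log (1/ε) / ε²`
    (∀ ε₀ : ℝ, 0 < ε₀ → ε₀ < 1 → ∃ c K : ℝ, 0 < c ∧ 0 < K ∧
      ∀ (n d k : ℕ) (ε : ℝ) (A : Fin n → KMeansFilter.Pt d),
        1 ≤ d → 1 ≤ k → 0 < ε → ε ≤ ε₀ →
        0.99 ≤ (volume : Measure (Fin n → unitInterval)).real
            {u | KMeansFilter.IsAdditiveCoreset k ε A
              (KMeansFilter.coresetOf (c * (d * k * Real.log (1 / ε) / ε ^ 2)) A u)} ∧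
        ∀ hn : 2 ≤ n, A ⟨0, by omega⟩ ≠ A ⟨1, by omega⟩ →
          Integrable (fun u : Fin n → unitInterval =>
            ((KMeansFilter.coresetOf (c * (d * k * Real.log (1 / ε) / ε ^ 2)) A u).length : ℝ)) ∧
          ∫ u : Fin n → unitInterval,
              ((KMeansFilter.coresetOf (c * (d * k * Real.log (1 / ε) / ε ^ 2)) A u).length : ℝ) ≤
            K * (d * k * Real.log (1 / ε) / ε ^ 2 *
              (Real.log n + Real.log (KMeansFilter.meanCost A) -
                Real.log (KMeansFilter.sqDist (KMeansFilter.prefixMean A 2) (A ⟨1, by omega⟩))))) ∧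
    -- update time and working space `O(d)`, by one program for all dimensions and inputs
    (∃ (P : KMeansFilter.Prog) (K : ℕ), ∀ (d : ℕ) (r : ℝ), 1 ≤ d → 0 < r →
      ∀ stream : List (KMeansFilter.Pt d × unitInterval), ∃ s : KMeansFilter.Config,
        KMeansFilter.RunsOnline (K * d) (K * d) P (KMeansFilter.Config.start r) stream s ∧
        s.out = KMeansFilter.encode (KMeansFilter.parametricFilter r stream)) := by
  constructor
  · intro ε₀ hε₀ hε₀1
    have hl₀ : 0 < Real.log (1 / ε₀) := Real.log_pos (by rw [lt_div_iff₀ hε₀]; linarith)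
    obtain ⟨c, hc⟩ : ∃ c : ℝ, c = 10 ^ 9 * (1 + 1 / Real.log (1 / ε₀)) := ⟨_, rfl⟩
    have hc0 : 0 < c := by rw [hc]; positivity
    refine ⟨c, 23 * c + 2 / Real.log (1 / ε₀), hc0, by positivity, ?_⟩
    intro n d k ε A hd hk hε hεε
    refine ⟨KMeansFilter.accuracy hε₀ hε₀1 hc A hd hk hε hεε, fun hn hA => ?_⟩
    refine ⟨KMeansFilter.integrable_length_coresetOf _ A, ?_⟩
    refine KMeansFilter.integral_length_coresetOf_le hc0 hl₀ ?_ rfl A _ _ hA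
    have hll : Real.log (1 / ε₀) ≤ Real.log (1 / ε) :=
      Real.log_le_log (by positivity) (one_div_le_one_div_of_le hε hεε)
    have hdk : (1 : ℝ) ≤ d * k :=
      one_le_mul_of_one_le_of_one_le (by exact_mod_cast hd) (by exact_mod_cast hk)
    have hl : 0 < Real.log (1 / ε) := hl₀.trans_le hll
    have h1 : Real.log (1 / ε) ≤ d * k * Real.log (1 / ε) := le_mul_of_one_le_left hl.le hdk
    have h2 : ε ^ 2 ≤ 1 := pow_le_one₀ hε.le (by linarith)
    rw [le_div_iff₀ (by positivity)]
    nlinarith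
  -- For `d ≥ 1` both `13 d + 25` steps and `10 + d` cells are at most `40 d`.
  · refine ⟨KMeansFilter.filterProg, 40, fun d r hd hr stream => ?_⟩
    obtain ⟨s, hrun, hs⟩ := KMeansFilter.runsOnline_filterProg (B := 40 * d) (T := 40 * d)
      (by omega) (by omega) hr stream _ _ (KMeansFilter.represents_start r) le_rfl
    exact ⟨s, hrun, hs.out⟩
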